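/- Let $n$ be a natural number and let $B_r\subset\mathbb R^n$ be the open ball of radius $r$ about the origin. For all real numbers $K, F, \Lambda$ there is a constant $C=C(n,K,F,\Lambda)$ with the following property. Let $u\in C^4(\bar B_1)$ be convex on $B_1$, let $f=f(x,z,p)$ be a real function of class $C^2$ on an open subset of $\mathbb R^n\times\mathbb R\times\mathbb R^n$ that contains the points $(x,u(x),\nabla u(x))$, $x\in B_1$, and suppose that $$\sigma_2(\nabla^2u(x))=f(x,u(x),\nabla u(x))>0,\qquad x\in B_1,$$ where $\sigma_2(\nabla^2u)$ is the second elementary symmetric function of the eigenvalues of the Hessian matrix $\nabla^2u$. Suppose further that $|u|\le K$ and $|\nabla u|\le K$ on $B_1$, and that at all the points $(x,u(x),\nabla u(x))$ with $x\in B_1$ the function $f$ and its first and second derivatives $Df$, $D^2f$ are bounded in norm by $F$, and $1/f\le\Lambda$. Then $$\max_{x\in \bar B_{1/2}}|\nabla^2u(x)|\le C .$$ -/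

import Mathlib

open Set Metric

noncomputable section

/-- `σ_k(A)`: the `k`-th elementary symmetric function of the eigenvalues of a real matrix `A`,
counted with multiplicity (real symmetric matrices have all their eigenvalues in `ℝ`). -/
def sigmaK {n : ℕ} (k : ℕ) (A : Matrix (Fin n) (Fin n) ℝ) : ℝ :=
  A.charpoly.roots.esymm k

/-- For a symmetric matrix, `sigmaK` is the elementary symmetric function of the list of
eigenvalues given by the spectral theorem. -/
theorem sigmaK_eq_esymm_eigenvalues {n : ℕ} (k : ℕ) (A : Matrix (Fin n) (Fin n) ℝ)
    (hA : A.IsHermitian) :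
    sigmaK k A = (Finset.univ.val.map hA.eigenvalues).esymm k := by
  unfold sigmaK
  rw [hA.roots_charpoly_eq_eigenvalues]
  rfl

/-- The Hessian matrix `(∂ᵢ∂ⱼ u (x))ᵢⱼ` of a function on Euclidean space. -/
def hessianMatrix {n : ℕ} (u : EuclideanSpace ℝ (Fin n) → ℝ) (x : EuclideanSpace ℝ (Fin n)) :
    Matrix (Fin n) (Fin n) ℝ :=
  Matrix.of fun i j =>
    iteratedFDeriv ℝ 2 u x ![EuclideanSpace.single i (1 : ℝ), EuclideanSpace.single j (1 : ℝ)]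

/-- The point `(x, u(x), ∇u(x))` at which the right-hand side of the equation is evaluated. -/
def oneJet {n : ℕ} (u : EuclideanSpace ℝ (Fin n) → ℝ) (x : EuclideanSpace ℝ (Fin n)) :
    EuclideanSpace ℝ (Fin n) × ℝ × EuclideanSpace ℝ (Fin n) :=
  (x, u x, gradient u x)

end

/-! The proof applies the maximum principle to `auxiliaryFunction`, over points of the closed ball
of radius 3/4 and unit directions. Its logarithm is 2 log ρ + α|∇u|²/2 + β(x·∇u − u) + log log u_ξξ,
with ρ = 9/16 − |x|². At a maximum the direction may be taken to be a top eigenvector of the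
Hessian, with eigenvalue l. By convexity the other eigenvalues are nonnegative, and since σ₂ = f
lies between m > 0 and F, their sum η is comparable to 1/l once l is large (`sum_sub_apply_bounds`).
The linearized operator diag(l + η − λᵢ) is therefore of size l in every direction except the top
one, where it is only η.

Differentiating the equation twice gives a Jacobi inequality (`jacobi_inequality`): up to a
first-order term in f_p and an error O(l), the linearized operator applied to b = log u₁₁ is at
least half the squared gradient of b. Passing to log b keeps the squared gradient V of log b with
the large coefficient b/2 − 1. The first-order condition cancels the f_p terms, and the α term
contributes αηl² ≥ αml/2 (`maximum_point_inequality`).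

These gains have to be outweighed by a cutoff error of size l/ρ, which fails when ρ²b is large
(`maximum_point_contradiction`). If ρ is not small, the α term wins. If ρ is small and x has a
sizeable top component, the β term forces the gradient of log b to have size l in that direction.
Otherwise the cutoff gradient lies mostly in directions of ellipticity l, and the first-order
condition gives V ≥ l/ρ². So ρ² log l is bounded at the maximum, hence log u_ξξ is bounded on the
half ball. -/

/-! ### Second derivative test, directional derivatives and convexity. -/

section Calculus
open Filter Topology

/-- If `h` has a local maximum at `a`, its derivative vanishes and its second derivative is
nonpositive there. -/
theorem IsLocalMax.deriv_zero_and_second_deriv_nonpos {h h' : ℝ → ℝ} {a c : ℝ}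
    (hmax : IsLocalMax h a) (hd : ∀ᶠ t in 𝓝 a, HasDerivAt h (h' t) t)
    (hd' : HasDerivAt h' c a) : h' a = 0 ∧ c ≤ 0 := by
  have h0 : h' a = 0 := hmax.hasDerivAt_eq_zero hd.self_of_nhds
  refine ⟨h0, ?_⟩
  by_contra! hc
  have e1 : deriv h =ᶠ[𝓝 a] h' := hd.mono fun t ht => ht.deriv
  have e2 : deriv (deriv h) a = c := by rw [e1.deriv_eq, hd'.deriv]
  -- A positive second derivative would also make `a` a local minimum, so `h` would be locally
  -- constant and `c` would vanish.
  have hmin : IsLocalMin h a := isLocalMin_of_deriv_deriv_pos (by rw [e2]; exact hc)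
    (by rw [hd.self_of_nhds.deriv, h0]) hd.self_of_nhds.continuousAt
  have e3 : h =ᶠ[𝓝 a] fun _ => h a := by
    filter_upwards [hmin, hmax] with t h1 h2 using le_antisymm h2 h1
  have e4 : h' =ᶠ[𝓝 a] fun _ => 0 := by
    filter_upwards [e1, e3.eventuallyEq_nhds] with t h1 h2
    rw [← h1, h2.deriv_eq, deriv_const]
  have := hd'.unique ((hasDerivAt_const a (0 : ℝ)).congr_of_eventuallyEq e4)
  linarith

variable {E : Type*} [NormedAddCommGroup E] [NormedSpace ℝ E]

/-- The derivative of `φ` in the direction `v`, as a function. -/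
noncomputable def dirDeriv (v : E) (φ : E → ℝ) : E → ℝ := fun x => fderiv ℝ φ x v

theorem ContDiffOn.dirDeriv {φ : E → ℝ} {Ω : Set E} {m k : WithTop ℕ∞} (hφ : ContDiffOn ℝ k φ Ω)
    (hΩ : IsOpen Ω) (hmk : m + 1 ≤ k) (v : E) : ContDiffOn ℝ m (dirDeriv v φ) Ω :=
  (hφ.fderiv_of_isOpen hΩ hmk).clm_apply contDiffOn_const

theorem ContDiffOn.hasFDerivAt {φ : E → ℝ} {Ω : Set E} {k : WithTop ℕ∞} (hφ : ContDiffOn ℝ k φ Ω)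
    (hΩ : IsOpen Ω) (hk : k ≠ 0) {x : E} (hx : x ∈ Ω) : HasFDerivAt φ (fderiv ℝ φ x) x :=
  ((hφ.contDiffAt (hΩ.mem_nhds hx)).differentiableAt hk).hasFDerivAt

theorem hasDerivAt_line (x v : E) (t : ℝ) : HasDerivAt (fun t : ℝ => x + t • v) v t := by
  simpa using ((hasDerivAt_id t).smul_const v).const_add x

theorem ContDiffOn.hasDerivAt_line {φ : E → ℝ} {Ω : Set E} {k : WithTop ℕ∞}
    (hφ : ContDiffOn ℝ k φ Ω) (hΩ : IsOpen Ω) (hk : k ≠ 0) {x v : E} {t : ℝ}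
    (hx : x + t • v ∈ Ω) :
    HasDerivAt (fun t : ℝ => φ (x + t • v)) (_root_.dirDeriv v φ (x + t • v)) t :=
  (hφ.hasFDerivAt hΩ hk hx).comp_hasDerivAt t (_root_.hasDerivAt_line x v t)

theorem eventually_line_mem {Ω : Set E} (hΩ : IsOpen Ω) {x : E} (hx : x ∈ Ω) (v : E) :
    ∀ᶠ t : ℝ in 𝓝 0, x + t • v ∈ Ω := by
  have : ContinuousAt (fun t : ℝ => x + t • v) 0 := (hasDerivAt_line x v 0).continuousAt
  exact this.eventually_mem (hΩ.mem_nhds (by simpa using hx))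

theorem dirDeriv_dirDeriv {φ : E → ℝ} {Ω : Set E} {k : WithTop ℕ∞} (hφ : ContDiffOn ℝ k φ Ω)
    (hΩ : IsOpen Ω) (hk : 2 ≤ k) {x : E} (hx : x ∈ Ω) (v w : E) :
    dirDeriv v (dirDeriv w φ) x = fderiv ℝ (fderiv ℝ φ) x v w := by
  have h1 : DifferentiableAt ℝ (fderiv ℝ φ) x :=
    (((hφ.of_le hk).fderiv_of_isOpen hΩ (m := 1) (by norm_num)).contDiffAt
      (hΩ.mem_nhds hx)).differentiableAt (by norm_num)
  have h2 := (h1.hasFDerivAt.clm_apply (hasFDerivAt_const w x)).fderiv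
  have h3 : dirDeriv v (dirDeriv w φ) x = fderiv ℝ (fun y => fderiv ℝ φ y w) x v := rfl
  rw [h3, h2]
  simp

theorem dirDeriv_comm {φ : E → ℝ} {Ω : Set E} {k : WithTop ℕ∞} (hφ : ContDiffOn ℝ k φ Ω)
    (hΩ : IsOpen Ω) (hk : 2 ≤ k) {x : E} (hx : x ∈ Ω) (v w : E) :
    dirDeriv v (dirDeriv w φ) x = dirDeriv w (dirDeriv v φ) x := by
  rw [dirDeriv_dirDeriv hφ hΩ hk hx, dirDeriv_dirDeriv hφ hΩ hk hx]
  have := ((hφ.of_le hk).contDiffAt (hΩ.mem_nhds hx)).isSymmSndFDerivAt (by simp)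
  exact this v w

theorem dirDeriv_congr {φ ψ : E → ℝ} {Ω : Set E} (hΩ : IsOpen Ω) (h : EqOn φ ψ Ω) {x : E}
    (hx : x ∈ Ω) (v : E) : dirDeriv v φ x = dirDeriv v ψ x := by
  unfold dirDeriv
  rw [(h.eventuallyEq_of_mem (hΩ.mem_nhds hx)).fderiv_eq]

theorem ConvexOn.dirDeriv_dirDeriv_nonneg {φ : E → ℝ} {Ω : Set E} {k : WithTop ℕ∞}
    (hc : ConvexOn ℝ Ω φ) (hφ : ContDiffOn ℝ k φ Ω) (hΩ : IsOpen Ω) (hk : 2 ≤ k) {x : E}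
    (hx : x ∈ Ω) (v : E) : 0 ≤ _root_.dirDeriv v (_root_.dirDeriv v φ) x := by
  have hφ1 := (hφ.of_le hk).dirDeriv hΩ (m := 1) (by norm_num) v
  have hφ2 : ContDiffOn ℝ 2 φ Ω := hφ.of_le hk
  have hpos := eventually_line_mem hΩ hx v
  have hneg := eventually_line_mem hΩ hx (-v)
  -- Midpoint convexity: the symmetric sum φ(x + tv) + φ(x − tv) is smallest at t = 0.
  have hmax : IsLocalMax (fun t : ℝ => -(φ (x + t • v) + φ (x + t • (-v)))) 0 := by
    filter_upwards [hpos, hneg] with t h1 h2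
    have := hc.2 h1 h2 (by norm_num : (0 : ℝ) ≤ 1 / 2) (by norm_num : (0 : ℝ) ≤ 1 / 2) (by norm_num)
    have e : (1 / 2 : ℝ) • (x + t • v) + (1 / 2 : ℝ) • (x + t • (-v)) = x := by module
    rw [e] at this
    simp only [smul_eq_mul] at this
    simp only [zero_smul, add_zero]
    linarith
  have hd := hmax.deriv_zero_and_second_deriv_nonpos
    (h' := fun t : ℝ => -(_root_.dirDeriv v φ (x + t • v) + _root_.dirDeriv (-v) φ (x + t • (-v))))
    (c := -(_root_.dirDeriv v (_root_.dirDeriv v φ) (x + (0 : ℝ) • v)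
      + _root_.dirDeriv (-v) (_root_.dirDeriv (-v) φ) (x + (0 : ℝ) • (-v)))) ?_ ?_
  · have e : _root_.dirDeriv (-v) (_root_.dirDeriv (-v) φ) x
        = _root_.dirDeriv v (_root_.dirDeriv v φ) x := by
      rw [dirDeriv_dirDeriv hφ hΩ hk hx, dirDeriv_dirDeriv hφ hΩ hk hx]; simp
    have := hd.2
    simp only [zero_smul, add_zero, e] at this
    linarith
  · filter_upwards [hpos, hneg] with t h1 h2
    exact ((hφ2.hasDerivAt_line hΩ (by norm_num) h1).add
      (hφ2.hasDerivAt_line hΩ (by norm_num) h2)).neg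
  · exact ((hφ1.hasDerivAt_line hΩ (by norm_num) (by simpa using hx)).add
      (((hφ2).dirDeriv hΩ (m := 1) (by norm_num) (-v)).hasDerivAt_line hΩ (by norm_num)
        (by simpa using hx))).neg

end Calculus

/-! ### σ₂ as a quadratic expression in the Hessian, in any orthonormal basis. -/

section SigmaTwo

theorem Multiset.two_mul_esymm_two (s : Multiset ℝ) :
    2 * s.esymm 2 = s.sum ^ 2 - (s.map fun a => a ^ 2).sum := by
  induction s using Multiset.induction_on with
  | empty => simp [Multiset.esymm, Multiset.powersetCard_zero_right]
  | cons a s ih =>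
    have h : (a ::ₘ s).esymm 2 = s.esymm 2 + a * s.sum := by
      have h1 : (s.map fun x => a * x).sum = a * s.sum := by
        simpa using Multiset.sum_map_mul_left (s := s) (a := a) (f := fun x => x)
      simp only [Multiset.esymm, Multiset.powersetCard_cons, Multiset.map_add, Multiset.sum_add,
        Multiset.map_map, Function.comp_def, Multiset.prod_cons, Multiset.powersetCard_one,
        Multiset.prod_singleton, h1, one_add_one_eq_two]
    rw [h, Multiset.sum_cons, Multiset.map_cons, Multiset.sum_cons]
    linarith

variable {n : ℕ}

/-- Both sides equal (tr T)² − tr T²: the eigenbasis evaluates the traces through eigenvalues, the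
basis `e` through matrix entries. -/
theorem LinearMap.IsSymmetric.two_mul_esymm_two_roots_charpoly {ι : Type*} [Fintype ι] [DecidableEq ι]
    {E : Type*} [NormedAddCommGroup E] [InnerProductSpace ℝ E] [FiniteDimensional ℝ E]
    {T : E →ₗ[ℝ] E} (hT : T.IsSymmetric) (e : OrthonormalBasis ι ℝ E) :
    2 * T.charpoly.roots.esymm 2 =
      (∑ i, inner ℝ (e i) (T (e i))) ^ 2 - ∑ i, ∑ j, inner ℝ (e i) (T (e j)) ^ 2 := by
  have hn : Module.finrank ℝ E = Module.finrank ℝ E := rfl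
  set b := hT.eigenvectorBasis hn
  set μ := hT.eigenvalues hn
  have hTb : ∀ k, T (b k) = μ k • b k := fun k => by
    exact hT.apply_eigenvectorBasis hn k
  have hroots : T.charpoly.roots = Finset.univ.val.map μ := by
    simpa using hT.roots_charpoly_eq_eigenvalues hn
  rw [hroots, Multiset.two_mul_esymm_two, Multiset.map_map]
  have htr : LinearMap.trace ℝ E T = ∑ i, μ i := by
    rw [T.trace_eq_sum_inner b]
    simp [hTb, inner_smul_right]
  have htr' : LinearMap.trace ℝ E (T ∘ₗ T) = ∑ i, μ i ^ 2 := by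
    rw [(T ∘ₗ T).trace_eq_sum_inner b]
    simp [hTb, inner_smul_right, pow_two]
  have htr2 : LinearMap.trace ℝ E (T ∘ₗ T) = ∑ i, ∑ j, inner ℝ (e i) (T (e j)) ^ 2 := by
    rw [(T ∘ₗ T).trace_eq_sum_inner e]
    refine Finset.sum_congr rfl fun i _ => ?_
    rw [LinearMap.comp_apply, ← hT, ← e.sum_inner_mul_inner]
    refine Finset.sum_congr rfl fun j _ => ?_
    rw [hT, ← hT (e j), real_inner_comm (e i), pow_two]
  rw [← T.trace_eq_sum_inner e, ← htr2, htr, htr']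
  simp [Finset.sum]

theorem ContinuousLinearMap.inner_toEuclideanLin
    (B : EuclideanSpace ℝ (Fin n) →L[ℝ] EuclideanSpace ℝ (Fin n) →L[ℝ] ℝ)
    (v w : EuclideanSpace ℝ (Fin n)) :
    inner ℝ v (Matrix.toEuclideanLin (Matrix.of fun i j =>
      B (EuclideanSpace.single i (1 : ℝ)) (EuclideanSpace.single j (1 : ℝ))) w) = B v w := by
  have hv : v = ∑ i, v i • EuclideanSpace.single i (1 : ℝ) := by
    simpa using ((EuclideanSpace.basisFun (Fin n) ℝ).sum_repr v).symm
  have hw : w = ∑ i, w i • EuclideanSpace.single i (1 : ℝ) := by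
    simpa using ((EuclideanSpace.basisFun (Fin n) ℝ).sum_repr w).symm
  conv_rhs => rw [hv, hw]
  simp only [map_sum, map_smul, sum_apply, smul_apply,
    smul_eq_mul]
  simp only [PiLp.inner_apply, Matrix.ofLp_toLpLin, Matrix.toLin'_apply, Matrix.mulVec,
    dotProduct, Matrix.of_apply, RCLike.inner_apply, conj_trivial, Finset.sum_mul]
  rw [Finset.sum_comm]
  refine Finset.sum_congr rfl fun i _ => ?_
  rw [Finset.mul_sum]
  refine Finset.sum_congr rfl fun j _ => ?_
  ring

theorem ContinuousLinearMap.isSymmetric_toEuclideanLin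
    {B : EuclideanSpace ℝ (Fin n) →L[ℝ] EuclideanSpace ℝ (Fin n) →L[ℝ] ℝ}
    (hB : ∀ v w, B v w = B w v) :
    (Matrix.toEuclideanLin (Matrix.of fun i j =>
      B (EuclideanSpace.single i (1 : ℝ)) (EuclideanSpace.single j (1 : ℝ)))).IsSymmetric := by
  intro v w
  rw [real_inner_comm, B.inner_toEuclideanLin, B.inner_toEuclideanLin, hB]

/-- The basis `e` is arbitrary, so the equation can be differentiated in a fixed frame chosen to
diagonalize the Hessian at one point. -/
theorem two_mul_sigmaK_two
    {B : EuclideanSpace ℝ (Fin n) →L[ℝ] EuclideanSpace ℝ (Fin n) →L[ℝ] ℝ}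
    (hB : ∀ v w, B v w = B w v) (e : OrthonormalBasis (Fin n) ℝ (EuclideanSpace ℝ (Fin n))) :
    2 * sigmaK 2 (Matrix.of fun i j =>
      B (EuclideanSpace.single i (1 : ℝ)) (EuclideanSpace.single j (1 : ℝ))) =
      (∑ i, B (e i) (e i)) ^ 2 - ∑ i, ∑ j, B (e i) (e j) ^ 2 := by
  have h := (B.isSymmetric_toEuclideanLin hB).two_mul_esymm_two_roots_charpoly e
  simp only [B.inner_toEuclideanLin] at h
  rw [← h, sigmaK, ← LinearMap.charpoly_toMatrix _ (PiLp.basisFun 2 ℝ (Fin n))]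
  congr 4
  rw [Matrix.toEuclideanLin_eq_toLin, LinearMap.toMatrix_toLin]

theorem exists_orthonormalBasis_diagonalizing
    {B : EuclideanSpace ℝ (Fin n) →L[ℝ] EuclideanSpace ℝ (Fin n) →L[ℝ] ℝ}
    (hB : ∀ v w, B v w = B w v) :
    ∃ (e : OrthonormalBasis (Fin n) ℝ (EuclideanSpace ℝ (Fin n))) (μ : Fin n → ℝ),
      ∀ v w, B v w = ∑ i, μ i * (inner ℝ (e i) v * inner ℝ (e i) w) := by
  have hn : Module.finrank ℝ (EuclideanSpace ℝ (Fin n)) = n := by simp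
  have hT := B.isSymmetric_toEuclideanLin hB
  refine ⟨hT.eigenvectorBasis hn, hT.eigenvalues hn, fun v w => ?_⟩
  rw [← B.inner_toEuclideanLin, ← (hT.eigenvectorBasis hn).sum_inner_mul_inner]
  refine Finset.sum_congr rfl fun i _ => ?_
  rw [← hT, hT.apply_eigenvectorBasis, real_inner_comm v, inner_smul_left]
  simp
  ring

end SigmaTwo

/-! ### Eigenvalue bounds and the Jacobi inequality at a point. -/

section PointwiseAlgebra
open Finset

variable {n : ℕ}

/-- With η the sum of the other eigenvalues and l the distinguished one, 2φ = 2lη + η² − ∑λᵢ² over i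
≠ o, and that last sum lies between 0 and η². Hence lη ≤ φ; then F ≤ l² forces η ≤ l, so φ ≤ 2lη. -/
theorem sum_sub_apply_bounds {lam : Fin n → ℝ} {o : Fin n} {φ m F : ℝ} (h0 : ∀ i, 0 ≤ lam i)
    (hσ : (∑ i, lam i) ^ 2 - ∑ i, lam i ^ 2 = 2 * φ) (hm : m ≤ φ) (hF : φ ≤ F)
    (hpos : 0 < lam o) (hl : F ≤ lam o ^ 2) :
    0 ≤ ∑ i, lam i - lam o ∧ (∑ i, lam i - lam o) * lam o ≤ F ∧
      m ≤ 2 * ((∑ i, lam i - lam o) * lam o) ∧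
      ∀ i, i ≠ o → lam i ≤ ∑ i, lam i - lam o := by
  have e1 := add_sum_erase univ lam (mem_univ o)
  have e2 := add_sum_erase univ (fun i => lam i ^ 2) (mem_univ o)
  set η := ∑ i, lam i - lam o with hη
  have e3 : η = ∑ i ∈ univ.erase o, lam i := by rw [hη]; linarith
  have h1 : 0 ≤ η := e3 ▸ sum_nonneg fun i _ => h0 i
  have h2 : 0 ≤ ∑ i ∈ univ.erase o, lam i ^ 2 := sum_nonneg fun i _ => sq_nonneg _
  have h3 : ∑ i ∈ univ.erase o, lam i ^ 2 ≤ η ^ 2 := by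
    rw [e3]; exact sum_sq_le_sq_sum_of_nonneg fun i _ => h0 i
  have e4 : ∑ i, lam i = lam o + η := by rw [hη]; ring
  rw [e4, ← e2] at hσ
  have h4 : η * lam o ≤ F := by nlinarith
  have h5 : η ≤ lam o := by
    by_contra! h
    nlinarith
  refine ⟨h1, h4, by nlinarith, fun i hi => ?_⟩
  rw [e3]
  exact single_le_sum (f := lam) (fun j _ => h0 j) (mem_erase.2 ⟨hi, mem_univ i⟩)

/-- Only the diagonal entries and the row and column of index `o` are kept; by symmetry the latter
two coincide, hence the factor 2. -/
theorem sum_sq_third_derivatives_ge {T : Fin n → Fin n → Fin n → ℝ}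
    (hT : ∀ i j k, T i j k = T j i k) (o : Fin n) :
    ∑ i, T i i o ^ 2 + 2 * ∑ i ∈ univ.erase o, T i o o ^ 2 ≤ ∑ i, ∑ j, T i j o ^ 2 := by
  have e1 := add_sum_erase univ (fun i => ∑ j, T i j o ^ 2) (mem_univ o)
  have e2 := add_sum_erase univ (fun j => T o j o ^ 2) (mem_univ o)
  have e3 := add_sum_erase univ (fun i => T i i o ^ 2) (mem_univ o)
  have e4 : ∑ i ∈ univ.erase o, T o i o ^ 2 = ∑ i ∈ univ.erase o, T i o o ^ 2 :=
    sum_congr rfl fun i _ => by rw [hT]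
  have e5 : ∑ i ∈ univ.erase o, (T i i o ^ 2 + T i o o ^ 2) ≤
      ∑ i ∈ univ.erase o, ∑ j, T i j o ^ 2 := by
    refine sum_le_sum fun i hi => ?_
    rw [← sum_pair (f := fun j => T i j o ^ 2) (ne_of_mem_erase hi)]
    exact sum_le_sum_of_subset_of_nonneg (subset_univ _) fun _ _ _ => sq_nonneg _
  rw [sum_add_distrib] at e5
  linarith

/-- The scalar inequality behind the Jacobi inequality for `log u₁₁`. -/
theorem jacobi_scalar {l η t S Q R T g G A F m N : ℝ} (hl : 1 ≤ l) (hη : 0 < η) (hN : 1 ≤ N)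
    (hm : 0 < m) (hmη : m ≤ 2 * (η * l)) (hηl : 24 * N * η ≤ l) (hQ : 0 ≤ Q) (hT : 0 ≤ T)
    (hR : R ^ 2 ≤ N * η ^ 2 * Q) (hS : l * S = g - η * t - R) (hg : g ^ 2 ≤ 4 * F ^ 2 * l ^ 2)
    (hG : A - 8 * F * l ^ 2 ≤ G) :
    l * A - (8 * F + 64 * F ^ 2 / m + 12 * F ^ 2) * l ^ 3 + (η * t ^ 2 + (l + η) * T) / 2 ≤
      l * (G - (t + S) ^ 2 + t ^ 2 + Q + 2 * T) - η * t ^ 2 - (l + η) * T := by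
  have hl0 : 0 < l := by linarith
  have hη1 : η ≤ N * η := by nlinarith
  -- The decisive gain: the differentiated equation `hS` turns the cross term of −(t + S)² into
  -- +2ηt², which exceeds the −ηt² produced by the logarithm.
  have a1 : -(2 * l * t * S) = 2 * η * t ^ 2 + 2 * t * R - 2 * t * g := by
    linear_combination (-2 * t) * hS
  -- The budget is ηt²/2 and lQ. The bounds `a2`, `a3`, `a4` spend ηt²/8 each, and `a2`, `a3` spend
  -- lQ/4 and lQ/2.
  have a2 : l * S ^ 2 ≤ 12 * F ^ 2 * l ^ 3 + η * t ^ 2 / 8 + l / 4 * Q := by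
    have c2 : 24 * η ≤ l := by linarith
    have b1 : (l * S) ^ 2 ≤ 3 * (g ^ 2 + (η * t) ^ 2 + R ^ 2) := by
      rw [hS]
      linarith [sq_nonneg (g + η * t), sq_nonneg (g + R), sq_nonneg (η * t - R)]
    have b2 : 3 * g ^ 2 ≤ l * (12 * F ^ 2 * l ^ 3) := by
      have : l ^ 2 ≤ l ^ 4 := pow_le_pow_right₀ hl (by norm_num)
      have := mul_le_mul_of_nonneg_left this (sq_nonneg F)
      linarith
    have b3 : 3 * (η * t) ^ 2 ≤ l * (η * t ^ 2 / 8) := by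
      have := mul_le_mul_of_nonneg_right c2 (by positivity : 0 ≤ η * t ^ 2)
      linarith
    have b4 : 3 * R ^ 2 ≤ l * (l / 4 * Q) := by
      have c1 : 24 * N * η * η ≤ l * η := mul_le_mul_of_nonneg_right hηl hη.le
      have c4 : 24 * η * l ≤ l * l := mul_le_mul_of_nonneg_right c2 hl0.le
      have c3 : 3 * (N * η ^ 2) ≤ l ^ 2 / 4 := by linarith [mul_self_nonneg l]
      have := mul_le_mul_of_nonneg_right c3 hQ
      linarith
    have : l * (l * S ^ 2) ≤ l * (12 * F ^ 2 * l ^ 3 + η * t ^ 2 / 8 + l / 4 * Q) := by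
      linarith
    exact le_of_mul_le_mul_left this hl0
  have a3 : -(η * t ^ 2 / 8 + l / 2 * Q) ≤ 2 * t * R := by
    have b1 : 0 ≤ (η * t + 8 * R) ^ 2 := sq_nonneg _
    have b2 : 8 * (N * η ^ 2 * Q) ≤ η * (l / 2 * Q) := by
      have := mul_le_mul_of_nonneg_right hηl (by positivity : 0 ≤ η * Q)
      have : 0 ≤ η * Q * l := by positivity
      linarith
    have : η * (-(η * t ^ 2 / 8 + l / 2 * Q)) ≤ η * (2 * t * R) := by linarith
    exact le_of_mul_le_mul_left this hη
  have a4 : 2 * t * g ≤ η * t ^ 2 / 8 + 64 * F ^ 2 / m * l ^ 3 := by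
    have b1 : 0 ≤ (η * t - 8 * g) ^ 2 := sq_nonneg _
    have b2 : 32 * F ^ 2 * l ^ 2 ≤ η * (64 * F ^ 2 / m * l ^ 3) := by
      have : η * (64 * F ^ 2 / m * l ^ 3) = 32 * F ^ 2 * l ^ 2 * (2 * (η * l) / m) := by
        field_simp; ring
      rw [this]
      refine le_mul_of_one_le_right (by positivity) ?_
      rwa [one_le_div hm]
    have : η * (2 * t * g) ≤ η * (η * t ^ 2 / 8 + 64 * F ^ 2 / m * l ^ 3) := by linarith
    exact le_of_mul_le_mul_left this hη
  have a5 : 0 ≤ (l / 2 - 3 / 2 * η) * T := mul_nonneg (by linarith) hT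
  have a6 : l * (A - 8 * F * l ^ 2) ≤ l * G := mul_le_mul_of_nonneg_left hG hl0.le
  have a7 : 0 ≤ l * Q := by positivity
  have a8 : 0 ≤ η * t ^ 2 := by positivity
  linarith

/-- Here `T` and `q` stand for third and fourth derivatives and `o` for the top direction. Since l +
η − λᵢ = l + (η − λᵢ), the first differentiated equation determines S = ∑_{i≠o} `T i i o` up to the
small remainder R. Cauchy–Schwarz with |η − λᵢ| ≤ η controls R, which reduces everything to
`jacobi_scalar`. -/
theorem jacobi_inequality {lam q a : Fin n → ℝ} {T : Fin n → Fin n → Fin n → ℝ} {o : Fin n}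
    {g G F m : ℝ} (hTs : ∀ i j k, T i j k = T j i k)
    (h0 : ∀ i, 0 ≤ lam i) (hl : 1 ≤ lam o) (hη : 0 < ∑ i, lam i - lam o)
    (hle : ∀ i, i ≠ o → lam i ≤ ∑ i, lam i - lam o) (hm : 0 < m)
    (hmη : m ≤ 2 * ((∑ i, lam i - lam o) * lam o))
    (hηl : 24 * n * (∑ i, lam i - lam o) ≤ lam o)
    (h1 : ∑ i, (∑ j, lam j - lam i) * T i i o = g)
    (h2 : ∑ i, (∑ j, lam j - lam i) * q i =
      G - (∑ i, T i i o) ^ 2 + ∑ i, ∑ j, T i j o ^ 2)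
    (hg : |g| ≤ 2 * F * lam o)
    (hG : ∑ k, a k * T k o o - 8 * F * lam o ^ 2 ≤ G) :
    1 / 2 * ∑ i, (∑ j, lam j - lam i) * (T i o o / lam o) ^ 2 + ∑ k, a k * (T k o o / lam o)
        - (8 * F + 64 * F ^ 2 / m + 12 * F ^ 2) * lam o ≤
      ∑ i, (∑ j, lam j - lam i) * (q i / lam o - (T i o o / lam o) ^ 2) := by
  set l := lam o with hl_def
  set η := ∑ i, lam i - l with hη_def
  have hn : (1 : ℝ) ≤ n := by
    have : 0 < n := Fin.pos o
    exact_mod_cast this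
  have hl0 : 0 < l := by linarith
  have hF : ∀ i, ∑ j, lam j - lam i = l + η - lam i := fun i => by rw [hη_def]; ring
  simp only [hF] at h1 h2 ⊢
  have e1 := add_sum_erase univ (fun i => (l + η - lam i) * T i i o) (mem_univ o)
  have e2 := add_sum_erase univ (fun i => T i i o) (mem_univ o)
  have e3 := add_sum_erase univ (fun i => T i i o ^ 2) (mem_univ o)
  have e4 := add_sum_erase univ (fun i => (l + η - lam i) * T i o o ^ 2) (mem_univ o)
  simp only [← hl_def] at e1 e4
  set S := ∑ i ∈ univ.erase o, T i i o
  set Q := ∑ i ∈ univ.erase o, T i i o ^ 2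
  set R := ∑ i ∈ univ.erase o, (η - lam i) * T i i o
  set T2 := ∑ i ∈ univ.erase o, T i o o ^ 2
  have e5 : ∑ i ∈ univ.erase o, (l + η - lam i) * T i i o = l * S + R := by
    rw [mul_sum, ← sum_add_distrib]
    exact sum_congr rfl fun i _ => by ring
  have hR : R ^ 2 ≤ n * η ^ 2 * Q := by
    have b1 : R ^ 2 ≤ (∑ i ∈ univ.erase o, (η - lam i) ^ 2) * Q := sum_mul_sq_le_sq_mul_sq _ _ _
    have b2 : ∑ i ∈ univ.erase o, (η - lam i) ^ 2 ≤ n * η ^ 2 := by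
      have : ∑ i ∈ univ.erase o, (η - lam i) ^ 2 ≤ ∑ i ∈ univ.erase o, η ^ 2 := by
        refine sum_le_sum fun i hi => ?_
        have := hle i (ne_of_mem_erase hi)
        have := h0 i
        nlinarith
      refine this.trans ?_
      refine (sum_le_sum_of_subset_of_nonneg (subset_univ _) fun _ _ _ => sq_nonneg _).trans ?_
      simp
    exact b1.trans (mul_le_mul_of_nonneg_right b2 (sum_nonneg fun _ _ => sq_nonneg _))
  have hg2 : g ^ 2 ≤ 4 * F ^ 2 * l ^ 2 := by
    have := sq_le_sq' (abs_le.1 hg).1 (abs_le.1 hg).2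
    nlinarith
  have key := jacobi_scalar (t := T o o o) (S := S) (Q := Q) (R := R) (T := T2) (g := g) (G := G)
    (A := ∑ k, a k * T k o o) (F := F) hl hη hn hm hmη hηl
    (sum_nonneg fun _ _ => sq_nonneg _) (sum_nonneg fun _ _ => sq_nonneg _) hR
    (by rw [← h1, ← e1, e5]; ring) hg2 hG
  have hsq := sum_sq_third_derivatives_ge hTs o
  have e6 : ∑ i ∈ univ.erase o, (l + η - lam i) * T i o o ^ 2 ≤ (l + η) * T2 := by
    rw [mul_sum]
    refine sum_le_sum fun i _ => ?_
    have := h0 i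
    nlinarith [sq_nonneg (T i o o)]
  have f1 : ∑ i, (l + η - lam i) * (T i o o / l) ^ 2 =
      (∑ i, (l + η - lam i) * T i o o ^ 2) / l ^ 2 := by
    rw [sum_div]
    exact sum_congr rfl fun i _ => by rw [div_pow]; ring
  have f2 : ∑ k, a k * (T k o o / l) = l * (∑ k, a k * T k o o) / l ^ 2 := by
    rw [mul_sum, sum_div]
    exact sum_congr rfl fun i _ => by field_simp
  have f3 : ∑ i, (l + η - lam i) * (q i / l - (T i o o / l) ^ 2) =
      (l * (∑ i, (l + η - lam i) * q i) - ∑ i, (l + η - lam i) * T i o o ^ 2) / l ^ 2 := by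
    rw [mul_sum, ← sum_sub_distrib, sum_div]
    exact sum_congr rfl fun i _ => by field_simp
  rw [f1, f2, f3, h2]
  have f4 : ∀ C : ℝ, C * l = C * l ^ 3 / l ^ 2 := fun C => by field_simp
  rw [f4, mul_div_assoc', ← add_div, ← sub_div]
  refine div_le_div_of_nonneg_right ?_ (by positivity)
  rw [← e2, ← e4]
  have f5 : l * (T o o o ^ 2 + Q + 2 * T2) ≤ l * ∑ i, ∑ j, T i j o ^ 2 :=
    mul_le_mul_of_nonneg_left (by rw [e3]; exact hsq) hl0.le
  have f6 : (l + η - l) * T o o o ^ 2 = η * T o o o ^ 2 := by ring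
  rw [f6]
  linarith

end PointwiseAlgebra

/-! ### First- and second-order conditions at the maximum, and the case analysis. -/

section MaximumPoint
open Finset

variable {n : ℕ}

/-- In a direction whose eigenvalue μ is at most η, the critical equation says that the cutoff
gradient is almost `v`; squaring the sum costs a factor 2. -/
theorem eight_mul_sq_div_le {α β K η u x μ v ρ : ℝ} (hα : 0 ≤ α) (hβ : 0 ≤ β) (hu : |u| ≤ K)
    (hx : |x| ≤ 1) (hμ : 0 ≤ μ) (hμη : μ ≤ η) (hcrit : 4 * x / ρ = (α * u + β * x) * μ + v) :
    8 * x ^ 2 / ρ ^ 2 ≤ v ^ 2 + (α * K + β) ^ 2 * η ^ 2 := by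
  have s2 : |(α * u + β * x) * μ| ≤ (α * K + β) * η := by
    have s1 : |α * u + β * x| ≤ α * K + β := by
      refine (abs_add_le _ _).trans ?_
      rw [abs_mul, abs_mul, abs_of_nonneg hα, abs_of_nonneg hβ]
      have t2 := mul_le_mul_of_nonneg_left hu hα
      have t3 := mul_le_mul_of_nonneg_left hx hβ
      linarith
    rw [abs_mul, abs_of_nonneg hμ]
    exact mul_le_mul s1 hμη hμ ((abs_nonneg _).trans s1)
  have s3 := sq_le_sq' (abs_le.1 s2).1 (abs_le.1 s2).2
  have s4 : 8 * x ^ 2 / ρ ^ 2 = (4 * x / ρ) ^ 2 / 2 := by ring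
  rw [s4, hcrit]
  linarith [sq_nonneg ((α * u + β * x) * μ - v)]

/-- The case analysis at an interior maximum point, once third derivatives only enter through the
logarithmic gradient `v`. -/
theorem maximum_point_contradiction {lam u x v : Fin n → ℝ} {o : Fin n}
    {l η b ρ K m β N : ℝ} (hN : 1 ≤ N) (hNn : (n : ℝ) = N) (hlo : lam o = l)
    (h0 : ∀ i, 0 ≤ lam i) (hle : ∀ i, i ≠ o → lam i ≤ η) (hη : 0 < η)
    (hm : 0 < m) (hmη : m ≤ 2 * (η * l))
    (hK : 0 ≤ K) (hβ : β = 2 * (450 * N / m) * K + 2)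
    (hu : ∀ i, |u i| ≤ K) (hx : ∀ i, |x i| ≤ 1) (hρ : 0 < ρ) (hρ1 : ρ ≤ 1)
    (hxρ : ∑ i, x i ^ 2 = 9 / 16 - ρ)
    (hcrit : ∀ i, 4 * x i / ρ = (450 * N / m * u i + β * x i) * lam i + v i)
    (hηs : N * (450 * N / m * K + β) ^ 2 * η ≤ 1) (hη1 : η ≤ 1)
    (hb1 : 57 * N < b) (hb2 : 449 * N / m < b * ρ ^ 2) (hl1 : 8 ≤ l * ρ)
    (hmain : b / 4 * ∑ i, (l + η - lam i) * v i ^ 2 + 450 * N / m * m * l / 2 ≤ 14 * N * l / ρ) :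
    False := by
  set α := 450 * N / m with hα
  set L := α * K + β with hL
  have hα0 : 0 < α := by positivity
  have hβ0 : 0 < β := by rw [hβ]; positivity
  have hl0 : 0 < l := by
    by_contra! h
    have := mul_nonpos_of_nonneg_of_nonpos hη.le h
    linarith
  have hb0 : 0 < b := by linarith
  have hFnn : ∀ i, 0 ≤ l + η - lam i := fun i => by
    by_cases h : i = o
    · subst h; linarith
    · have := hle i h; linarith
  set V := ∑ i, (l + η - lam i) * v i ^ 2 with hV
  have hV0 : 0 ≤ V := sum_nonneg fun i _ => mul_nonneg (hFnn i) (sq_nonneg _)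
  have hmain' : (b / 4 * V + α * m * l / 2) * ρ ≤ 14 * N * l := by
    rwa [le_div_iff₀ hρ] at hmain
  have hαm : α * m = 450 * N := by rw [hα]; field_simp
  rw [hαm] at hmain'
  have hNl : 0 < N * l := by positivity
  -- All three cases must beat 14Nl/ρ: the constants satisfy 450 > 2·16·14, 449 > 4·8·14 and 57 >
  -- 4·14. When ρ < 1/16, |x|² > 1/2, so either the top component or the rest carries at least 1/4.
  by_cases hcase : 1 / 16 ≤ ρ
  · have h1 : 0 ≤ b / 4 * V * ρ := by positivity
    have h2 : 450 * N * l / 2 * (1 / 16) ≤ 450 * N * l / 2 * ρ :=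
      mul_le_mul_of_nonneg_left hcase (by positivity)
    linarith
  push Not at hcase
  have hVb : b / 4 * V * ρ ≤ 14 * N * l := by
    have : 0 ≤ 450 * N * l / 2 * ρ := by positivity
    linarith
  have e1 := add_sum_erase univ (fun i => x i ^ 2) (mem_univ o)
  have e2 := add_sum_erase univ (fun i => (l + η - lam i) * v i ^ 2) (mem_univ o)
  by_cases hxo : 1 / 4 ≤ x o ^ 2
  · have hxo' : 1 / 2 ≤ |x o| := by
      by_contra! h
      have := abs_nonneg (x o)
      have h3 := pow_lt_pow_left₀ h this two_ne_zero
      rw [sq_abs] at h3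
      linarith
    -- The choice β = 2αK + 2 gives β|x o| ≥ αK + 1, which dominates α|u o| by at least 1.
    have h1 : 1 ≤ |α * u o + β * x o| := by
      have t1 : |β * x o| - |α * u o| ≤ |α * u o + β * x o| := by
        have := abs_sub_abs_le_abs_sub (β * x o) (-(α * u o))
        rw [abs_neg] at this
        refine this.trans (le_of_eq ?_)
        congr 1; ring
      rw [abs_mul, abs_mul, abs_of_pos hα0, abs_of_pos hβ0] at t1
      have t2 := mul_le_mul_of_nonneg_left (hu o) hα0.le
      have t3 := mul_le_mul_of_nonneg_left hxo' hβ0.le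
      linarith
    have h2 : l / 2 ≤ |v o| := by
      have t0 : v o = -((α * u o + β * x o) * l - 4 * x o / ρ) := by rw [hcrit o, hlo]; ring
      have t1 : |(α * u o + β * x o) * l| - |4 * x o / ρ| ≤ |v o| := by
        rw [t0, abs_neg]; exact abs_sub_abs_le_abs_sub _ _
      have t2 : |4 * x o / ρ| ≤ l / 2 := by
        rw [abs_div, abs_mul, abs_of_pos hρ, div_le_iff₀ hρ]
        norm_num
        have := hx o
        linarith
      rw [abs_mul, abs_of_pos hl0] at t1
      have t3 := mul_le_mul_of_nonneg_right h1 hl0.le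
      linarith
    have h3 : l ^ 2 / 4 ≤ v o ^ 2 := by
      have := mul_self_le_mul_self (by positivity) h2
      rw [abs_mul_abs_self] at this
      linarith
    have h4 : m * l / 8 ≤ V := by
      have t1 : η * (l ^ 2 / 4) ≤ η * v o ^ 2 := mul_le_mul_of_nonneg_left h3 hη.le
      have t2 : m * l ≤ 2 * (η * l) * l := mul_le_mul_of_nonneg_right hmη hl0.le
      have t3 : 0 ≤ ∑ i ∈ univ.erase o, (l + η - lam i) * v i ^ 2 :=
        sum_nonneg fun i _ => mul_nonneg (hFnn i) (sq_nonneg _)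
      have t4 : (l + η - lam o) * v o ^ 2 = η * v o ^ 2 := by rw [hlo]; ring
      rw [hV, ← e2]
      linarith
    have h5 : b / 4 * (m * l / 8) * ρ ≤ 14 * N * l :=
      (mul_le_mul_of_nonneg_right (mul_le_mul_of_nonneg_left h4 (by positivity)) hρ.le).trans hVb
    have h6 : b * ρ ^ 2 ≤ b * ρ := by
      have : ρ ^ 2 ≤ ρ := pow_le_of_le_one hρ.le hρ1 two_ne_zero
      exact mul_le_mul_of_nonneg_left this hb0.le
    have h7 : 449 * N < b * ρ * m := by
      have := hb2.trans_le h6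
      rwa [div_lt_iff₀ hm] at this
    have h8 := mul_lt_mul_of_pos_right h7 hl0
    linarith
  · push Not at hxo
    have h1 : 1 / 4 ≤ ∑ i ∈ univ.erase o, x i ^ 2 := by linarith
    have h2 : ∀ i ∈ univ.erase o, 8 * x i ^ 2 / ρ ^ 2 - L ^ 2 * η ^ 2 ≤ v i ^ 2 := fun i hi =>
      sub_le_iff_le_add.2 (eight_mul_sq_div_le hα0.le hβ0.le (hu i) (hx i) (h0 i)
        (hle i (ne_of_mem_erase hi)) (hcrit i))
    have h3 : 1 / ρ ^ 2 ≤ ∑ i ∈ univ.erase o, v i ^ 2 := by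
      refine le_trans ?_ (sum_le_sum h2)
      rw [sum_sub_distrib, ← sum_div, ← mul_sum]
      have t1 : ∑ i ∈ univ.erase o, L ^ 2 * η ^ 2 ≤ 1 := by
        refine (sum_le_sum_of_subset_of_nonneg (subset_univ _) fun _ _ _ => by positivity).trans ?_
        simp only [sum_const, card_univ, Fintype.card_fin, nsmul_eq_mul, hNn]
        have := mul_le_mul hηs hη1 hη.le zero_le_one
        linarith
      have t2 : 1 ≤ 1 / ρ ^ 2 := by
        rw [one_le_div (by positivity)]
        exact pow_le_one₀ hρ.le hρ1
      have t3 : 2 * (1 / ρ ^ 2) ≤ (8 * ∑ i ∈ univ.erase o, x i ^ 2) / ρ ^ 2 := by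
        rw [mul_one_div]
        exact div_le_div_of_nonneg_right (by linarith) (by positivity)
      linarith
    have h4 : l * (1 / ρ ^ 2) ≤ V := by
      rw [hV, ← e2]
      have t1 : l * ∑ i ∈ univ.erase o, v i ^ 2 ≤
          ∑ i ∈ univ.erase o, (l + η - lam i) * v i ^ 2 := by
        rw [mul_sum]
        refine sum_le_sum fun i hi => mul_le_mul_of_nonneg_right ?_ (sq_nonneg _)
        have := hle i (ne_of_mem_erase hi)
        linarith
      have t2 := mul_nonneg (hFnn o) (sq_nonneg (v o))
      have t3 := mul_le_mul_of_nonneg_left h3 hl0.le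
      linarith
    have h5 : b / 4 * (l * (1 / ρ ^ 2)) * ρ ≤ 14 * N * l :=
      (mul_le_mul_of_nonneg_right (mul_le_mul_of_nonneg_left h4 (by positivity)) hρ.le).trans hVb
    have h6 : b / 4 * (l * (1 / ρ ^ 2)) * ρ = b * l / 4 * (1 / ρ) := by field_simp
    have h7 : 1 ≤ 1 / ρ := by rwa [one_le_div hρ]
    have h8 := mul_le_mul_of_nonneg_left h7 (by positivity : 0 ≤ b * l / 4)
    have h9 := mul_lt_mul_of_pos_right hb1 hl0
    linarith

/-- The differential inequality at a maximum point, contracted with the linearized operator. -/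
theorem maximum_point_inequality {lam u x q a g : Fin n → ℝ} {T : Fin n → Fin n → Fin n → ℝ}
    {o : Fin n} {l η b ρ K M F α β N C : ℝ}  (hNn : (n : ℝ) = N) (hlo : lam o = l)
    (h0 : ∀ i, 0 ≤ lam i) (hFnn : ∀ i, 0 ≤ l + η - lam i)
    (hα : 0 ≤ α) (hβ : 0 ≤ β) (hl0 : 0 < l) (hb : 0 < b)
    (hu : ∀ i, |u i| ≤ K) (hx : ∀ i, |x i| ≤ 1) (hρ : 0 < ρ)
    (ha : ∀ i, |a i| ≤ F) (hgb : ∀ i, |g i - a i * lam i| ≤ M)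
    (h1 : ∀ k, ∑ i, (l + η - lam i) * T i i k = g k)
    (hjac : 1 / 2 * ∑ i, (l + η - lam i) * (T i o o / l) ^ 2 + ∑ k, a k * (T k o o / l) - C * l ≤
      ∑ i, (l + η - lam i) * (q i / l - (T i o o / l) ^ 2))
    (hcrit : ∀ i, 4 * x i / ρ = (α * u i + β * x i) * lam i + T i o o / (l * b))
    (hhess : ∀ i, -4 / ρ - 8 * x i ^ 2 / ρ ^ 2 + α * (lam i ^ 2 + ∑ k, u k * T i i k) +
      β * (lam i + ∑ k, x k * T i i k) + (q i / l - (T i o o / l) ^ 2) / b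
        - (T i o o / (l * b)) ^ 2 ≤ 0) :
    (b / 2 - 1) * ∑ i, (l + η - lam i) * (T i o o / (l * b)) ^ 2 + α * (η * l ^ 2) ≤
      4 / ρ * (N * (l + η)) + 8 / ρ ^ 2 * ∑ i, (l + η - lam i) * x i ^ 2 +
        N * ((α * K + β) * M) + N * (4 * F / ρ) + C * l / b := by
  have hsum : ∑ i, (l + η - lam i) * (-4 / ρ - 8 * x i ^ 2 / ρ ^ 2 +
      α * (lam i ^ 2 + ∑ k, u k * T i i k) + β * (lam i + ∑ k, x k * T i i k) +
      (q i / l - (T i o o / l) ^ 2) / b - (T i o o / (l * b)) ^ 2) ≤ 0 :=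
    sum_nonpos fun i _ => mul_nonpos_of_nonneg_of_nonpos (hFnn i) (hhess i)
  have hsplit : ∑ i, (l + η - lam i) * (-4 / ρ - 8 * x i ^ 2 / ρ ^ 2 +
      α * (lam i ^ 2 + ∑ k, u k * T i i k) + β * (lam i + ∑ k, x k * T i i k) +
      (q i / l - (T i o o / l) ^ 2) / b - (T i o o / (l * b)) ^ 2) =
      -(4 / ρ * ∑ i, (l + η - lam i)) - 8 / ρ ^ 2 * ∑ i, (l + η - lam i) * x i ^ 2 +
      α * ∑ i, (l + η - lam i) * lam i ^ 2 + β * ∑ i, (l + η - lam i) * lam i +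
      ∑ k, (α * u k + β * x k) * g k +
      (1 / b) * ∑ i, (l + η - lam i) * (q i / l - (T i o o / l) ^ 2) -
      ∑ i, (l + η - lam i) * (T i o o / (l * b)) ^ 2 := by
    -- The third derivatives coming from the gradient terms enter only through the differentiated
    -- equation `h1`.
    have hswap : ∑ k, (α * u k + β * x k) * g k =
        ∑ i, (l + η - lam i) * (α * ∑ k, u k * T i i k + β * ∑ k, x k * T i i k) := by
      simp only [← h1, mul_sum, ← sum_add_distrib]
      rw [sum_comm]
      refine sum_congr rfl fun i _ => sum_congr rfl fun k _ => ?_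
      ring
    rw [hswap]
    obtain ⟨P, hP⟩ : ∃ P : Fin n → ℝ, ∀ i, ∑ k, u k * T i i k = P i := ⟨_, fun _ => rfl⟩
    obtain ⟨Q, hQ⟩ : ∃ Q : Fin n → ℝ, ∀ i, ∑ k, x k * T i i k = Q i := ⟨_, fun _ => rfl⟩
    simp only [hP, hQ]
    simp only [mul_sum, ← sum_neg_distrib, ← sum_add_distrib, ← sum_sub_distrib]
    refine sum_congr rfl fun i _ => ?_
    ring
  have hgk : ∑ k, (4 * a k * x k / ρ - a k * (T k o o / (l * b)) - (α * K + β) * M) ≤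
      ∑ k, (α * u k + β * x k) * g k := by
    refine sum_le_sum fun k _ => ?_
    -- The critical equation removes the unbounded factor `lam k`. The resulting term in `T k o o`
    -- cancels the first-order term of `hjac` divided by `b`.
    have s1 : (α * u k + β * x k) * (a k * lam k) =
        4 * a k * x k / ρ - a k * (T k o o / (l * b)) := by
      linear_combination (-a k) * hcrit k
    have s2 : |α * u k + β * x k| ≤ α * K + β := by
      refine (abs_add_le _ _).trans ?_
      rw [abs_mul, abs_mul, abs_of_nonneg hα, abs_of_nonneg hβ]
      have t2 := mul_le_mul_of_nonneg_left (hu k) hα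
      have t3 := mul_le_mul_of_nonneg_left (hx k) hβ
      linarith
    have s3 : |(α * u k + β * x k) * (g k - a k * lam k)| ≤ (α * K + β) * M := by
      rw [abs_mul]
      exact mul_le_mul s2 (hgb k) (abs_nonneg _) ((abs_nonneg _).trans s2)
    have s4 := (abs_le.1 s3).1
    linarith
  have hgk2 : -(N * (4 * F / ρ)) ≤ ∑ k, 4 * a k * x k / ρ := by
    have : ∑ k : Fin n, -(4 * F / ρ) ≤ ∑ k, 4 * a k * x k / ρ := by
      refine sum_le_sum fun k _ => ?_
      rw [← neg_div]
      refine div_le_div_of_nonneg_right ?_ hρ.le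
      have : |a k * x k| ≤ F := by
        rw [abs_mul]
        nlinarith [abs_nonneg (a k), abs_nonneg (x k), ha k, hx k]
      have := (abs_le.1 this).1
      linarith
    simpa [hNn] using this
  rw [sum_sub_distrib, sum_sub_distrib] at hgk
  simp only [sum_const, card_univ, Fintype.card_fin, nsmul_eq_mul, hNn] at hgk
  have hjb := mul_le_mul_of_nonneg_left hjac (by positivity : 0 ≤ 1 / b)
  have e1 : ∑ i, (l + η - lam i) * (T i o o / l) ^ 2 =
      b ^ 2 * ∑ i, (l + η - lam i) * (T i o o / (l * b)) ^ 2 := by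
    rw [mul_sum]
    exact sum_congr rfl fun i _ => by field_simp
  have e2 : ∑ k, a k * (T k o o / l) = b * ∑ k, a k * (T k o o / (l * b)) := by
    rw [mul_sum]
    exact sum_congr rfl fun i _ => by field_simp
  rw [e1, e2] at hjb
  set V := ∑ i, (l + η - lam i) * (T i o o / (l * b)) ^ 2
  set A := ∑ k, a k * (T k o o / (l * b))
  have e3 : 1 / b * (1 / 2 * (b ^ 2 * V) + b * A - C * l) = b / 2 * V + A - C * l / b := by
    field_simp
  rw [e3] at hjb
  have e4 : ∑ i, (l + η - lam i) ≤ N * (l + η) := by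
    have : ∑ i, (l + η - lam i) ≤ ∑ i : Fin n, (l + η) :=
      sum_le_sum fun i _ => by linarith [h0 i]
    rwa [sum_const, card_univ, Fintype.card_fin, nsmul_eq_mul, hNn] at this
  have e5 := mul_le_mul_of_nonneg_left e4 (by positivity : 0 ≤ 4 / ρ)
  -- The top direction alone suffices: ηl is bounded below, so this term is of order l.
  have e6 : η * l ^ 2 ≤ ∑ i, (l + η - lam i) * lam i ^ 2 := by
    have := single_le_sum (f := fun i => (l + η - lam i) * lam i ^ 2)
      (fun i _ => mul_nonneg (hFnn i) (sq_nonneg _)) (mem_univ o)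
    simp only [hlo] at this
    linarith
  have e7 := mul_le_mul_of_nonneg_left e6 hα
  have e8 : 0 ≤ β * ∑ i, (l + η - lam i) * lam i :=
    mul_nonneg hβ (sum_nonneg fun i _ => mul_nonneg (hFnn i) (h0 i))
  rw [hsplit] at hsum
  linarith

end MaximumPoint

/-! ### Choice of constants and the bound on ρ²b. -/

section MaximumPointEstimate
open Finset

/-- The constant is 14 = 8 + 4 + 1 + 1: the cutoff Laplacian, the `F` term, the Jacobi error and `P
+ Q`. Since b ≥ 8, the coefficient b/2 − 2 left after absorbing `X` is at least b/4. -/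
theorem absorb_lower_order {V X P Q b α m l η N F ρ C : ℝ} (hα : 0 ≤ α) (hV : 0 ≤ V)
    (hb : 0 < b) (hb8 : 8 ≤ b) (hCb : C ≤ b) (hl : 0 < l) (hηl : η ≤ l)
    (hmη : m ≤ 2 * (η * l)) (hρ : 0 < ρ) (hρN : ρ ≤ N) (hFl : F ≤ l)
    (hmain : (b / 2 - 1) * V + α * (η * l ^ 2) ≤
      4 / ρ * (N * (l + η)) + X + P + N * (4 * F / ρ) + C * l / b)
    (hX : X ≤ V + Q) (hPQ : P + Q ≤ l) :
    b / 4 * V + α * m * l / 2 ≤ 14 * N * l / ρ := by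
  have s1 : b / 4 * V ≤ (b / 2 - 2) * V := mul_le_mul_of_nonneg_right (by linarith) hV
  have s2 : α * m * l / 2 ≤ α * (η * l ^ 2) := by
    have := mul_le_mul_of_nonneg_left hmη (by positivity : 0 ≤ α * l)
    linarith
  have hNρ : 0 ≤ N / ρ := div_nonneg (hρ.le.trans hρN) hρ.le
  have s3 : 4 / ρ * (N * (l + η)) ≤ 8 * (N / ρ * l) := by
    have := mul_le_mul_of_nonneg_left (by linarith : l + η ≤ 2 * l) hNρ
    have e : 4 / ρ * (N * (l + η)) = 4 * (N / ρ * (l + η)) := by ring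
    linarith
  have s4 : N * (4 * F / ρ) ≤ 4 * (N / ρ * l) := by
    have := mul_le_mul_of_nonneg_left hFl hNρ
    have e : N * (4 * F / ρ) = 4 * (N / ρ * F) := by ring
    linarith
  have s5 : C * l / b ≤ l := by
    rw [div_le_iff₀ hb, mul_comm]
    exact mul_le_mul_of_nonneg_left hCb hl.le
  have s6 : l ≤ N / ρ * l := le_mul_of_one_le_left hl.le ((one_le_div hρ).2 hρN)
  have e : 14 * N * l / ρ = 14 * (N / ρ * l) := by ring
  rw [e]
  linarith

/-- The algebraic estimate at a maximum point of the test function: `lam` are the eigenvalues of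
the Hessian, `T` the third derivatives, `q` the relevant fourth derivatives, `g` and `G` the first
and second derivatives of the right-hand side `φ`, and `a` its derivatives in the gradient
variable. -/
def MaximumPointBound (n : ℕ) (K F m α β C₀ : ℝ) : Prop :=
  ∀ (o : Fin n) (lam u x q a g : Fin n → ℝ) (T : Fin n → Fin n → Fin n → ℝ)
    (G φ ρ b : ℝ),
    (∀ i j k, T i j k = T j i k) → (∀ i, 0 ≤ lam i) →
    (∑ i, lam i) ^ 2 - ∑ i, lam i ^ 2 = 2 * φ → m ≤ φ → φ ≤ F →
    (∀ i, |u i| ≤ K) → 0 < ρ → ∑ i, x i ^ 2 = 9 / 16 - ρ → 0 < b → b ≤ lam o →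
    (∀ i, |a i| ≤ F) → (∀ i, |g i - a i * lam i| ≤ F * K) →
    ∑ k, a k * T k o o - 2 * F * (lam o + K) ^ 2 ≤ G →
    (∀ k, ∑ i, (∑ j, lam j - lam i) * T i i k = g k) →
    ∑ i, (∑ j, lam j - lam i) * q i = G - (∑ i, T i i o) ^ 2 + ∑ i, ∑ j, T i j o ^ 2 →
    (∀ i, 4 * x i / ρ = (α * u i + β * x i) * lam i + T i o o / (lam o * b)) →
    (∀ i, -4 / ρ - 8 * x i ^ 2 / ρ ^ 2 + α * (lam i ^ 2 + ∑ k, u k * T i i k) +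
      β * (lam i + ∑ k, x k * T i i k) + (q i / lam o - (T i o o / lam o) ^ 2) / b
        - (T i o o / (lam o * b)) ^ 2 ≤ 0) →
    ρ ^ 2 * b ≤ C₀

theorem maximum_point_estimate (n : ℕ) {K F m α β : ℝ} (hK : 1 ≤ K) (hF : 1 ≤ F) (hm : 0 < m)
    (hα : α = 450 * n / m) (hβ : β = 2 * (450 * n / m) * K + 2) :
    ∃ C₀ : ℝ, 1 ≤ C₀ ∧ MaximumPointBound n K F m α β C₀ := by
  set N : ℝ := (n : ℝ) with hN_def
  set L := α * K + β with hL
  set C := 8 * F + 64 * F ^ 2 / m + 12 * F ^ 2 with hC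
  set D := N * (L * (F * K)) + N * (2 * F * L ^ 2 + 8 * F) with hD
  have hN0 : 0 ≤ N := Nat.cast_nonneg n
  have hα0 : 0 ≤ α := by rw [hα]; positivity
  have hβ0 : 0 ≤ β := by rw [hβ]; positivity
  have hL0 : 0 ≤ L := by positivity
  have hC0 : 0 ≤ C := by positivity
  have hD0 : 0 ≤ D := by positivity
  -- Each group of summands is one largeness requirement on ρ²b; as ρ ≤ 1 and b ≤ l, these pass on
  -- to b and to l.
  refine ⟨8 + K + F + 24 * N * F + N * L ^ 2 * F + C + D + 57 * N + 449 * N / m, ?_, ?_⟩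
  · have : 0 ≤ 24 * N * F + N * L ^ 2 * F + C + D + 57 * N + 449 * N / m := by positivity
    linarith
  intro o lam u x q a g T G φ ρ b hT h0 hσ hmφ hφF hu hρ hxρ hb hbl ha hgb hG h1 h2 hcrit hhess
  by_contra! hlarge
  set l := lam o with hl_def
  have hN : 1 ≤ N := by
    have : 0 < n := Fin.pos o
    rw [hN_def]
    exact_mod_cast this
  have p1 : 0 ≤ 24 * N * F := by positivity
  have p2 : 0 ≤ N * L ^ 2 * F := by positivity
  have p3 : 0 ≤ 449 * N / m := by positivity
  have hρ1 : ρ ≤ 1 := by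
    have : 0 ≤ ∑ i, x i ^ 2 := sum_nonneg fun _ _ => sq_nonneg _
    linarith
  have hρ2 : ρ ^ 2 ≤ ρ := pow_le_of_le_one hρ.le hρ1 two_ne_zero
  have hbρ : ρ ^ 2 * b ≤ b := mul_le_of_le_one_left hb.le (hρ2.trans hρ1)
  have hlρ2 : ρ ^ 2 * b ≤ ρ ^ 2 * l := mul_le_mul_of_nonneg_left hbl (by positivity)
  have hl0 : 0 < l := hb.trans_le hbl
  have hlρ : ρ ^ 2 * l ≤ ρ * l := mul_le_mul_of_nonneg_right hρ2 hl0.le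
  have hN57 : 0 ≤ 57 * N := by linarith only [hN0]
  obtain ⟨c1, c2, c3, c4, c5, c6⟩ : 57 * N < ρ ^ 2 * b ∧ 449 * N / m < b * ρ ^ 2 ∧
      8 ≤ ρ ^ 2 * b ∧ D ≤ ρ ^ 2 * b ∧ C ≤ ρ ^ 2 * b ∧ K + F ≤ ρ ^ 2 * b := by
    refine ⟨?_, ?_, ?_, ?_, ?_, ?_⟩ <;> linarith only [hlarge, p1, p2, p3, hC0, hD0, hN57, hK, hF]
  obtain ⟨c7, c8⟩ : 24 * N * F ≤ ρ ^ 2 * b ∧ N * L ^ 2 * F ≤ ρ ^ 2 * b := by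
    refine ⟨?_, ?_⟩ <;> linarith only [hlarge, p1, p2, p3, hC0, hD0, hN57, hK, hF]
  clear hlarge p1 p2 p3
  have hbl' : ρ ^ 2 * b ≤ l := hbρ.trans hbl
  have hl1 : 1 ≤ l := by linarith only [c3, hbl']
  have hlF : F ≤ l := by linarith only [c6, hbl', hK]
  have hx : ∀ i, |x i| ≤ 1 := fun i => by
    have := single_le_sum (f := fun i => x i ^ 2) (fun _ _ => sq_nonneg _) (mem_univ i)
    rw [← sq_le_one_iff_abs_le_one]
    linarith
  obtain ⟨q1, q2, q3, q4⟩ := sum_sub_apply_bounds (o := o) h0 hσ hmφ hφF hl0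
    (by rw [← hl_def]; nlinarith)
  set η := ∑ i, lam i - lam o with hη_def
  have hη : ∑ i, lam i = l + η := by rw [hη_def]; ring
  have hη0 : 0 < η := by
    by_contra! h
    have := mul_nonpos_of_nonpos_of_nonneg h hl0.le
    linarith
  have hηsmall : ∀ c, 0 ≤ c → c * F ≤ l → c * η ≤ 1 := fun c hc h => by
    have s1 := mul_le_mul_of_nonneg_left q2 hc
    have s2 : (c * η) * l ≤ 1 * l := by linarith
    exact le_of_mul_le_mul_right s2 hl0
  have hη1 : η ≤ 1 := by simpa using hηsmall 1 zero_le_one (by linarith)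
  have hFnn : ∀ i, 0 ≤ l + η - lam i := fun i => by
    by_cases h : i = o
    · subst h; linarith
    · have := q4 i h; linarith
  have hlK : (l + K) ^ 2 ≤ 4 * l ^ 2 := by
    have := pow_le_pow_left₀ (by positivity) (by linarith : l + K ≤ 2 * l) 2
    linarith
  have hgo : |g o| ≤ 2 * F * l := by
    have s1 := hgb o
    have s2 : |a o * lam o| ≤ F * l := by
      rw [abs_mul, abs_of_nonneg (h0 o)]
      exact mul_le_mul_of_nonneg_right (ha o) hl0.le
    have s3 : F * K ≤ F * l := mul_le_mul_of_nonneg_left (by linarith) (by linarith)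
    have s4 := abs_sub_abs_le_abs_sub (g o) (a o * lam o)
    linarith
  have hjac := jacobi_inequality (F := F) (a := a) hT h0 hl1 hη0 q4 hm q3
    (by
      have := hηsmall (24 * N) (by positivity) (c7.trans hbl')
      exact this.trans hl1) (h1 o) h2 hgo
    (by
      have := mul_le_mul_of_nonneg_left hlK (by positivity : 0 ≤ 2 * F)
      linarith)
  simp only [hη] at h1 hjac
  have hmain := maximum_point_inequality (N := N) (M := F * K) rfl rfl h0 hFnn hα0 hβ0 hl0 hb hu
    hx hρ ha hgb h1 hjac hcrit hhess
  rw [← hL, ← hC, ← hl_def] at hmain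
  -- Off the top direction the critical equation absorbs the cutoff gradient into V. In the top
  -- direction, where that fails, the coefficient η ≤ F/l and ρ²l ≥ 1 give a direct bound.
  have hv : ∀ i, (l + η - lam i) * (8 * x i ^ 2 / ρ ^ 2) ≤
      (l + η - lam i) * (T i o o / (l * b)) ^ 2 + (2 * F * L ^ 2 + 8 * F) := fun i => by
    by_cases h : i = o
    · subst h
      have s1 : (l + η - lam i) * (8 * x i ^ 2 / ρ ^ 2) = 8 * (η * x i ^ 2) / ρ ^ 2 := by
        rw [← hl_def]; ring
      have s2 : 8 * (η * x i ^ 2) / ρ ^ 2 ≤ 8 * F := by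
        rw [div_le_iff₀ (by positivity)]
        have t1 : η * x i ^ 2 ≤ η :=
          mul_le_of_le_one_right hη0.le (by rw [sq_le_one_iff_abs_le_one]; exact hx i)
        have t2 := mul_le_mul_of_nonneg_left (by linarith only [c3, hlρ2] : 1 ≤ ρ ^ 2 * l) hη0.le
        have t3 := mul_le_mul_of_nonneg_right q2 (by positivity : 0 ≤ ρ ^ 2)
        linarith
      have s3 := mul_nonneg (hFnn i) (sq_nonneg (T i i i / (l * b)))
      have s4 : 0 ≤ 2 * F * L ^ 2 := by positivity
      linarith
    · have s1 := mul_le_mul_of_nonneg_left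
        (eight_mul_sq_div_le hα0 hβ0 (hu i) (hx i) (h0 i) (q4 i h) (hcrit i)) (hFnn i)
      have s2 : (l + η - lam i) * (L ^ 2 * η ^ 2) ≤ 2 * F * L ^ 2 := by
        have t1 : l + η - lam i ≤ 2 * l := by linarith [h0 i]
        have t2 := mul_le_mul_of_nonneg_right t1 (by positivity : 0 ≤ L ^ 2 * η ^ 2)
        have t3 : L ^ 2 * (η * (η * l)) ≤ L ^ 2 * (1 * F) :=
          mul_le_mul_of_nonneg_left (mul_le_mul hη1 q2 (by positivity) zero_le_one) (by positivity)
        linarith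
      rw [← hL, mul_add] at s1
      linarith
  have hxsum : 8 / ρ ^ 2 * ∑ i, (l + η - lam i) * x i ^ 2 ≤
      ∑ i, (l + η - lam i) * (T i o o / (l * b)) ^ 2 + N * (2 * F * L ^ 2 + 8 * F) := by
    have := sum_le_sum fun i (_ : i ∈ Finset.univ) => hv i
    rw [sum_add_distrib, sum_const, card_univ, Fintype.card_fin, nsmul_eq_mul, ← hN_def] at this
    refine le_trans (le_of_eq ?_) this
    rw [mul_sum]
    exact sum_congr rfl fun i _ => by ring
  refine maximum_point_contradiction (v := fun i => T i o o / (l * b)) (o := o) (l := l) (η := η)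
    (b := b) hN rfl rfl h0 q4 hη0 hm q3 (zero_le_one.trans hK) hβ hu hx hρ hρ1 hxρ
    (by rw [← hα]; exact hcrit) ?_ hη1 (c1.trans_le hbρ) c2
    (by linarith only [c3, hlρ2, hlρ]) ?_
  · rw [← hα]
    exact hηsmall (N * L ^ 2) (by positivity) (c8.trans hbl')
  · rw [← hα]
    exact absorb_lower_order hα0 (sum_nonneg fun i _ => mul_nonneg (hFnn i) (sq_nonneg _)) hb
      (c3.trans hbρ) (c5.trans hbρ) hl0 (hη1.trans hl1) q3 hρ (hρ1.trans hN) hlF hmain hxsum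
      (c4.trans hbl')

end MaximumPointEstimate

/-! ### Derivatives along lines of the test function and of σ₂. -/

section LineDerivatives
open Filter Topology

/-- First and second order conditions along a line for
`2 log ρ + Z + log (log H)`. -/
theorem IsLocalMax.log_test_function {ρ ρ' Z Z' H H' : ℝ → ℝ} {ρ₂ Z₂ H₂ : ℝ}
    (hρ : ∀ᶠ t in 𝓝 0, HasDerivAt ρ (ρ' t) t) (hρ' : HasDerivAt ρ' ρ₂ 0)
    (hZ : ∀ᶠ t in 𝓝 0, HasDerivAt Z (Z' t) t) (hZ' : HasDerivAt Z' Z₂ 0)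
    (hH : ∀ᶠ t in 𝓝 0, HasDerivAt H (H' t) t) (hH' : HasDerivAt H' H₂ 0)
    (hρ0 : 0 < ρ 0) (hH0 : 1 < H 0)
    (hmax : IsLocalMax (fun t => 2 * Real.log (ρ t) + Z t + Real.log (Real.log (H t))) 0) :
    2 * (ρ' 0 / ρ 0) + Z' 0 + H' 0 / (H 0 * Real.log (H 0)) = 0 ∧
      2 * (ρ₂ / ρ 0 - (ρ' 0 / ρ 0) ^ 2) + Z₂ +
        (H₂ / H 0 - (H' 0 / H 0) ^ 2) / Real.log (H 0)
          - (H' 0 / (H 0 * Real.log (H 0))) ^ 2 ≤ 0 := by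
  have cρ : ContinuousAt ρ 0 := hρ.self_of_nhds.continuousAt
  have cH : ContinuousAt H 0 := hH.self_of_nhds.continuousAt
  have eρ : ∀ᶠ t in 𝓝 0, 0 < ρ t := cρ.tendsto.eventually_const_lt hρ0
  have eH : ∀ᶠ t in 𝓝 0, 1 < H t := cH.tendsto.eventually_const_lt hH0
  have hb : 0 < Real.log (H 0) := Real.log_pos hH0
  have hHpos : 0 < H 0 := zero_lt_one.trans hH0
  have key := hmax.deriv_zero_and_second_deriv_nonpos
    (h' := fun t => 2 * (ρ' t / ρ t) + Z' t + H' t / H t / Real.log (H t))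
    (c := 2 * ((ρ₂ * ρ 0 - ρ' 0 * ρ' 0) / ρ 0 ^ 2) + Z₂ +
      ((H₂ * H 0 - H' 0 * H' 0) / H 0 ^ 2 * Real.log (H 0) -
        H' 0 / H 0 * (H' 0 / H 0)) / Real.log (H 0) ^ 2) ?_ ?_
  · refine ⟨?_, ?_⟩
    · have := key.1
      rwa [div_div] at this
    · refine le_trans (le_of_eq ?_) key.2
      field_simp
      ring
  · filter_upwards [hρ, hZ, hH, eρ, eH] with t h1 h2 h3 h4 h5
    exact (((h1.log h4.ne').const_mul 2).add h2).add
      ((h3.log (zero_lt_one.trans h5).ne').log (Real.log_pos h5).ne')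
  · exact (((hρ'.div hρ.self_of_nhds hρ0.ne').const_mul 2).add hZ').add
      ((hH'.div hH.self_of_nhds hHpos.ne').div
        (hH.self_of_nhds.log hHpos.ne') hb.ne')

variable {E : Type*} [NormedAddCommGroup E] [NormedSpace ℝ E]

theorem ContDiffOn.hasDerivAt_line_zero {φ : E → ℝ} {Ω : Set E} {k : WithTop ℕ∞}
    (hφ : ContDiffOn ℝ k φ Ω) (hΩ : IsOpen Ω) (hk : k ≠ 0) {x : E} (hx : x ∈ Ω) (v : E) :
    HasDerivAt (fun t : ℝ => φ (x + t • v)) (_root_.dirDeriv v φ x) 0 := by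
  simpa using hφ.hasDerivAt_line hΩ hk (x := x) (v := v) (t := 0) (by simpa using hx)

theorem hasDerivAt_sigma_two {ι : Type*} [Fintype ι] {w w' : ι → ι → ℝ → ℝ} {w₂ : ι → ι → ℝ}
    (hw : ∀ i j, HasDerivAt (w i j) (w' i j 0) 0)
    (hw' : ∀ i j, HasDerivAt (w' i j) (w₂ i j) 0) :
    HasDerivAt (fun t => (∑ i, w i i t) ^ 2 - ∑ i, ∑ j, w i j t ^ 2)
      (2 * ((∑ i, w i i 0) * (∑ i, w' i i 0) - ∑ i, ∑ j, w i j 0 * w' i j 0)) 0 ∧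
    HasDerivAt (fun t => (∑ i, w i i t) * (∑ i, w' i i t) - ∑ i, ∑ j, w i j t * w' i j t)
      ((∑ i, w' i i 0) ^ 2 + (∑ i, w i i 0) * (∑ i, w₂ i i) -
        ∑ i, ∑ j, (w' i j 0 ^ 2 + w i j 0 * w₂ i j)) 0 := by
  have h1 : HasDerivAt (fun t => ∑ i, w i i t) (∑ i, w' i i 0) 0 :=
    HasDerivAt.fun_sum fun i _ => hw i i
  have h2 : HasDerivAt (fun t => ∑ i, w' i i t) (∑ i, w₂ i i) 0 :=
    HasDerivAt.fun_sum fun i _ => hw' i i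
  refine ⟨?_, ?_⟩
  · have h3 : HasDerivAt (fun t => ∑ i, ∑ j, w i j t ^ 2)
        (∑ i, ∑ j, 2 * (w i j 0 * w' i j 0)) 0 :=
      HasDerivAt.fun_sum fun i _ => HasDerivAt.fun_sum fun j _ => by
        simpa [mul_assoc] using (hw i j).fun_pow 2
    refine ((h1.fun_pow 2).sub h3).congr_deriv ?_
    simp only [← Finset.mul_sum]
    push_cast
    ring
  · have h3 : HasDerivAt (fun t => ∑ i, ∑ j, w i j t * w' i j t)
        (∑ i, ∑ j, (w' i j 0 ^ 2 + w i j 0 * w₂ i j)) 0 :=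
      HasDerivAt.fun_sum fun i _ => HasDerivAt.fun_sum fun j _ =>
        ((hw i j).mul (hw' i j)).congr_deriv (by ring)
    exact ((h1.mul h2).sub h3).congr_deriv (by ring)

end LineDerivatives

/-! ### Derivatives along lines of the right-hand side f(x, u, ∇u). -/

section Jets
open Filter Topology

variable {n : ℕ}

theorem gradient_eq_sum_dirDeriv (e : OrthonormalBasis (Fin n) ℝ (EuclideanSpace ℝ (Fin n)))
    (u : EuclideanSpace ℝ (Fin n) → ℝ) (x : EuclideanSpace ℝ (Fin n)) :
    gradient u x = ∑ k, dirDeriv (e k) u x • e k := by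
  rw [← e.sum_repr' (gradient u x)]
  refine Finset.sum_congr rfl fun k _ => ?_
  rw [real_inner_comm, gradient, InnerProductSpace.toDual_symm_apply, dirDeriv]

theorem hasDerivAt_oneJet_line (e : OrthonormalBasis (Fin n) ℝ (EuclideanSpace ℝ (Fin n)))
    {u : EuclideanSpace ℝ (Fin n) → ℝ} {Ω : Set (EuclideanSpace ℝ (Fin n))}
    (hu : ContDiffOn ℝ 4 u Ω) (hΩ : IsOpen Ω) {x : EuclideanSpace ℝ (Fin n)} (hx : x ∈ Ω)
    (v : EuclideanSpace ℝ (Fin n)) :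
    HasDerivAt (fun t : ℝ => oneJet u (x + t • v))
      (v, dirDeriv v u x, ∑ k, dirDeriv v (dirDeriv (e k) u) x • e k) 0 := by
  refine (hasDerivAt_line x v 0).prodMk
    ((hu.hasDerivAt_line_zero hΩ (by norm_num) hx v).prodMk ?_)
  simp only [gradient_eq_sum_dirDeriv e]
  exact HasDerivAt.fun_sum fun k _ => ((hu.dirDeriv hΩ (m := 3) (by norm_num)
    (e k)).hasDerivAt_line_zero hΩ (by norm_num) hx v).smul_const (e k)

/-- The derivative in the direction `v` of the jet map. -/
noncomputable def jetDeriv (e : OrthonormalBasis (Fin n) ℝ (EuclideanSpace ℝ (Fin n)))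
    (u : EuclideanSpace ℝ (Fin n) → ℝ) (v x : EuclideanSpace ℝ (Fin n)) :
    EuclideanSpace ℝ (Fin n) × ℝ × EuclideanSpace ℝ (Fin n) :=
  (v, dirDeriv v u x, ∑ k, dirDeriv v (dirDeriv (e k) u) x • e k)

theorem hasDerivAt_jetDeriv_line (e : OrthonormalBasis (Fin n) ℝ (EuclideanSpace ℝ (Fin n)))
    {u : EuclideanSpace ℝ (Fin n) → ℝ} {Ω : Set (EuclideanSpace ℝ (Fin n))}
    (hu : ContDiffOn ℝ 4 u Ω) (hΩ : IsOpen Ω) {x : EuclideanSpace ℝ (Fin n)} (hx : x ∈ Ω)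
    (v : EuclideanSpace ℝ (Fin n)) :
    HasDerivAt (fun t : ℝ => jetDeriv e u v (x + t • v))
      (0, dirDeriv v (dirDeriv v u) x,
        ∑ k, dirDeriv v (dirDeriv v (dirDeriv (e k) u)) x • e k) 0 := by
  refine (hasDerivAt_const 0 v).prodMk
    (((hu.dirDeriv hΩ (m := 3) (by norm_num) v).hasDerivAt_line_zero hΩ (by norm_num) hx
      v).prodMk ?_)
  exact HasDerivAt.fun_sum fun k _ => (((hu.dirDeriv hΩ (m := 3) (by norm_num)
    (e k)).dirDeriv hΩ (m := 2) (by norm_num) v).hasDerivAt_line_zero hΩ (by norm_num) hx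
      v).smul_const (e k)

variable {F : Type*} [NormedAddCommGroup F] [NormedSpace ℝ F]

theorem hasDerivAt_comp_jet {f : F → ℝ} {U : Set F} (hU : IsOpen U) (hf : ContDiffOn ℝ 2 f U)
    {J J₁ : ℝ → F} {J₂ : F} (hJU : J 0 ∈ U) (hJ : HasDerivAt J (J₁ 0) 0)
    (hJ₁ : HasDerivAt J₁ J₂ 0) :
    HasDerivAt (fun t => f (J t)) (fderiv ℝ f (J 0) (J₁ 0)) 0 ∧
    HasDerivAt (fun t => fderiv ℝ f (J t) (J₁ t))
      (fderiv ℝ (fderiv ℝ f) (J 0) (J₁ 0) (J₁ 0) + fderiv ℝ f (J 0) J₂) 0 := by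
  have h1 : HasFDerivAt f (fderiv ℝ f (J 0)) (J 0) := hf.hasFDerivAt hU (by norm_num) hJU
  have h2 : HasFDerivAt (fderiv ℝ f) (fderiv ℝ (fderiv ℝ f) (J 0)) (J 0) :=
    (((hf.fderiv_of_isOpen hU (m := 1) (by norm_num)).contDiffAt
      (hU.mem_nhds hJU)).differentiableAt (by norm_num)).hasFDerivAt
  exact ⟨h1.comp_hasDerivAt 0 hJ, (h2.comp_hasDerivAt 0 hJ).clm_apply hJ₁⟩

end Jets

/-! ### From derivatives of u at a local maximum to the pointwise algebra. -/

section MaximumPrinciple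
open Filter Topology Finset

variable {n : ℕ}

local notation "𝔼" => EuclideanSpace ℝ (Fin n)

/-- Both sides of the equation are differentiated along lines. The first identity holds at every
point of `Ω`, so it can be differentiated once more. -/
theorem sigma_two_derivatives {u : 𝔼 → ℝ} {f : 𝔼 × ℝ × 𝔼 → ℝ} {U : Set (𝔼 × ℝ × 𝔼)} {Ω : Set 𝔼}
    (e : OrthonormalBasis (Fin n) ℝ 𝔼) (hΩ : IsOpen Ω) (hu : ContDiffOn ℝ 4 u Ω) (hU : IsOpen U)
    (hJU : ∀ x ∈ Ω, oneJet u x ∈ U) (hf : ContDiffOn ℝ 2 f U)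
    (heq : ∀ x ∈ Ω, (∑ i, dirDeriv (e i) (dirDeriv (e i) u) x) ^ 2 -
      ∑ i, ∑ j, dirDeriv (e i) (dirDeriv (e j) u) x ^ 2 = 2 * f (oneJet u x))
    {x : 𝔼} (hx : x ∈ Ω) (v : 𝔼) :
    (∑ i, dirDeriv (e i) (dirDeriv (e i) u) x) *
        (∑ i, dirDeriv v (dirDeriv (e i) (dirDeriv (e i) u)) x) -
      ∑ i, ∑ j, dirDeriv (e i) (dirDeriv (e j) u) x *
        dirDeriv v (dirDeriv (e i) (dirDeriv (e j) u)) x =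
      fderiv ℝ f (oneJet u x) (jetDeriv e u v x) ∧
    (∑ i, dirDeriv v (dirDeriv (e i) (dirDeriv (e i) u)) x) ^ 2 +
      (∑ i, dirDeriv (e i) (dirDeriv (e i) u) x) *
        (∑ i, dirDeriv v (dirDeriv v (dirDeriv (e i) (dirDeriv (e i) u))) x) -
      ∑ i, ∑ j, (dirDeriv v (dirDeriv (e i) (dirDeriv (e j) u)) x ^ 2 +
        dirDeriv (e i) (dirDeriv (e j) u) x *
          dirDeriv v (dirDeriv v (dirDeriv (e i) (dirDeriv (e j) u))) x) =
      fderiv ℝ (fderiv ℝ f) (oneJet u x) (jetDeriv e u v x) (jetDeriv e u v x) +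
        fderiv ℝ f (oneJet u x) (0, dirDeriv v (dirDeriv v u) x,
          ∑ k, dirDeriv v (dirDeriv v (dirDeriv (e k) u)) x • e k) := by
  have hw : ∀ i j, ContDiffOn ℝ 2 (dirDeriv (e i) (dirDeriv (e j) u)) Ω := fun i j =>
    (hu.dirDeriv hΩ (m := 3) (by norm_num) (e j)).dirDeriv hΩ (by norm_num) (e i)
  have hlhs : ∀ y ∈ Ω, _ := fun y hy => hasDerivAt_sigma_two
    (w := fun i j t => dirDeriv (e i) (dirDeriv (e j) u) (y + t • v))
    (w' := fun i j t => dirDeriv v (dirDeriv (e i) (dirDeriv (e j) u)) (y + t • v))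
    (fun i j => by simpa using (hw i j).hasDerivAt_line_zero hΩ (by norm_num) hy v)
    (fun i j => by
      simpa using ((hw i j).dirDeriv hΩ (m := 1) (by norm_num) v).hasDerivAt_line_zero hΩ
        (by norm_num) hy v)
  have hrhs : ∀ y ∈ Ω, _ := fun y hy => hasDerivAt_comp_jet hU hf
    (J := fun t : ℝ => oneJet u (y + t • v)) (J₁ := fun t : ℝ => jetDeriv e u v (y + t • v))
    (by simpa using hJU y hy) (by simpa [jetDeriv] using hasDerivAt_oneJet_line e hu hΩ hy v)
    (hasDerivAt_jetDeriv_line e hu hΩ hy v)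
  simp only [zero_smul, add_zero] at hlhs hrhs
  have first : ∀ y ∈ Ω, (∑ i, dirDeriv (e i) (dirDeriv (e i) u) y) *
        (∑ i, dirDeriv v (dirDeriv (e i) (dirDeriv (e i) u)) y) -
      ∑ i, ∑ j, dirDeriv (e i) (dirDeriv (e j) u) y *
        dirDeriv v (dirDeriv (e i) (dirDeriv (e j) u)) y =
      fderiv ℝ f (oneJet u y) (jetDeriv e u v y) := fun y hy => by
    have h1 := (hlhs y hy).1
    have h2 := (hrhs y hy).1.const_mul 2
    have h3 := h1.congr_of_eventuallyEq (f₁ := fun t : ℝ => 2 * f (oneJet u (y + t • v)))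
      (by filter_upwards [eventually_line_mem hΩ hy v] with t ht using (heq _ ht).symm)
    exact mul_left_cancel₀ two_ne_zero (h3.unique h2)
  refine ⟨first x hx, ?_⟩
  refine ((hlhs x hx).2.congr_of_eventuallyEq ?_).unique (hrhs x hx).2
  filter_upwards [eventually_line_mem hΩ hx v] with t ht using (first _ ht).symm

/-- The part `α |∇u|² / 2 + β (x · ∇u - u)` of the test function. -/
noncomputable def gradientTerm (α β : ℝ) (u : 𝔼 → ℝ) (x : 𝔼) : ℝ :=
  α / 2 * ‖gradient u x‖ ^ 2 + β * (inner ℝ x (gradient u x) - u x)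

theorem gradientTerm_eq (e : OrthonormalBasis (Fin n) ℝ 𝔼) (α β : ℝ) (u : 𝔼 → ℝ) (x : 𝔼) :
    gradientTerm α β u x = α / 2 * ∑ k, dirDeriv (e k) u x ^ 2 +
      β * (∑ k, inner ℝ (e k) x * dirDeriv (e k) u x - u x) := by
  have h : ∀ k, inner ℝ (e k) (gradient u x) = dirDeriv (e k) u x := fun k => by
    rw [real_inner_comm, gradient, InnerProductSpace.toDual_symm_apply, dirDeriv]
  rw [gradientTerm, ← e.sum_inner_mul_inner x, ← e.sum_sq_norm_inner_right (gradient u x)]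
  simp only [h, Real.norm_eq_abs, sq_abs, real_inner_comm]

theorem hasDerivAt_gradientTerm_line {u : 𝔼 → ℝ} {Ω : Set 𝔼}
    (e : OrthonormalBasis (Fin n) ℝ 𝔼) (hΩ : IsOpen Ω) (hu : ContDiffOn ℝ 4 u Ω) (α β : ℝ) {x : 𝔼}
    (i : Fin n) {t : ℝ} (hx : x + t • e i ∈ Ω) :
    HasDerivAt (fun t : ℝ => gradientTerm α β u (x + t • e i))
      (α * ∑ k, dirDeriv (e k) u (x + t • e i) * dirDeriv (e i) (dirDeriv (e k) u) (x + t • e i) +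
        β * ∑ k, inner ℝ (e k) (x + t • e i) *
          dirDeriv (e i) (dirDeriv (e k) u) (x + t • e i)) t ∧
    HasDerivAt (fun t : ℝ =>
      α * ∑ k, dirDeriv (e k) u (x + t • e i) * dirDeriv (e i) (dirDeriv (e k) u) (x + t • e i) +
        β * ∑ k, inner ℝ (e k) (x + t • e i) * dirDeriv (e i) (dirDeriv (e k) u) (x + t • e i))
      (α * ∑ k, (dirDeriv (e i) (dirDeriv (e k) u) (x + t • e i) ^ 2 +
          dirDeriv (e k) u (x + t • e i) *
            dirDeriv (e i) (dirDeriv (e i) (dirDeriv (e k) u)) (x + t • e i)) +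
        β * (dirDeriv (e i) (dirDeriv (e i) u) (x + t • e i) +
          ∑ k, inner ℝ (e k) (x + t • e i) *
            dirDeriv (e i) (dirDeriv (e i) (dirDeriv (e k) u)) (x + t • e i))) t := by
  have hu1 : ∀ k, ContDiffOn ℝ 3 (dirDeriv (e k) u) Ω := fun k =>
    hu.dirDeriv hΩ (by norm_num) (e k)
  have hu2 : ∀ k, ContDiffOn ℝ 2 (dirDeriv (e i) (dirDeriv (e k) u)) Ω := fun k =>
    (hu1 k).dirDeriv hΩ (by norm_num) (e i)
  have d0 := hu.hasDerivAt_line hΩ (by norm_num) hx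
  have d1 := fun k => (hu1 k).hasDerivAt_line hΩ (by norm_num) hx
  have d2 := fun k => (hu2 k).hasDerivAt_line hΩ (by norm_num) hx
  have dx : ∀ k, HasDerivAt (fun t : ℝ => inner ℝ (e k) (x + t • e i))
      (inner ℝ (e k) (e i)) t := fun k => by
    simpa using (hasDerivAt_const t (e k)).inner ℝ (hasDerivAt_line x (e i) t)
  have hδ : ∀ w : Fin n → ℝ, ∑ k, inner ℝ (e k) (e i) * w k = w i := fun w => by
    simp [e.inner_eq_ite]
  constructor
  · simp only [gradientTerm_eq e]
    refine (((HasDerivAt.fun_sum fun k _ => (d1 k).fun_pow 2).const_mul (α / 2)).add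
      (((HasDerivAt.fun_sum fun k _ => (dx k).mul (d1 k)).sub d0).const_mul β)).congr_deriv ?_
    rw [sum_add_distrib, hδ]
    simp only [mul_assoc, ← mul_sum]
    push_cast
    ring_nf
  · refine (((HasDerivAt.fun_sum fun k _ => (d1 k).mul (d2 k)).const_mul α).add
      ((HasDerivAt.fun_sum fun k _ => (dx k).mul (d2 k)).const_mul β)).congr_deriv ?_
    rw [sum_add_distrib (f := fun k => inner ℝ (e k) (e i) * _), hδ]
    simp only [pow_two]

theorem hasDerivAt_cutoff_line (x v : 𝔼) (r t : ℝ) (hv : ‖v‖ = 1) :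
    HasDerivAt (fun t : ℝ => r - ‖x + t • v‖ ^ 2) (-2 * inner ℝ v (x + t • v)) t ∧
    HasDerivAt (fun t : ℝ => -2 * inner ℝ v (x + t • v)) (-2) t := by
  constructor
  · refine ((hasDerivAt_line x v t).norm_sq.const_sub r).congr_deriv ?_
    rw [real_inner_comm]; ring
  · have h := ((hasDerivAt_const t v).inner ℝ (hasDerivAt_line x v t)).const_mul (-2)
    refine h.congr_deriv ?_
    simp [hv]

theorem norm_triple_le {E : Type*} [SeminormedAddCommGroup E] {a c : E} {b r : ℝ}
    (ha : ‖a‖ ≤ r) (hb : |b| ≤ r) (hc : ‖c‖ ≤ r) : ‖(a, b, c)‖ ≤ r := by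
  simp only [Prod.norm_def, Real.norm_eq_abs, sup_le_iff]
  exact ⟨ha, hb, hc⟩

/-- The frame `e` is frozen and diagonalizes the Hessian only at `x`. The scalar function to be
differentiated is thus u_oo in a fixed direction, not the top eigenvalue, which need not be smooth.
-/
theorem local_max_estimate {u : 𝔼 → ℝ} {f : 𝔼 × ℝ × 𝔼 → ℝ} {U : Set (𝔼 × ℝ × 𝔼)} {Ω : Set 𝔼}
    {K F m α β C₀ : ℝ} (hK : 1 ≤ K) (hF : 1 ≤ F)
    (hC₀ : MaximumPointBound n K F m α β C₀)
    (e : OrthonormalBasis (Fin n) ℝ 𝔼) (hΩ : IsOpen Ω) (hu : ContDiffOn ℝ 4 u Ω) (hU : IsOpen U)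
    (hJU : ∀ x ∈ Ω, oneJet u x ∈ U) (hf : ContDiffOn ℝ 2 f U)
    (heq : ∀ x ∈ Ω, (∑ i, dirDeriv (e i) (dirDeriv (e i) u) x) ^ 2 -
      ∑ i, ∑ j, dirDeriv (e i) (dirDeriv (e j) u) x ^ 2 = 2 * f (oneJet u x))
    {x : 𝔼} (hx : x ∈ Ω) (hxr : ‖x‖ < 3 / 4) {lam : Fin n → ℝ} (h0 : ∀ i, 0 ≤ lam i)
    (hdiag : ∀ i j, dirDeriv (e i) (dirDeriv (e j) u) x = if i = j then lam i else 0)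
    (hgrad : ∀ i, |dirDeriv (e i) u x| ≤ K) (hfm : m ≤ f (oneJet u x)) (hfF : f (oneJet u x) ≤ F)
    (hf1 : ‖fderiv ℝ f (oneJet u x)‖ ≤ F) (hf2 : ‖fderiv ℝ (fderiv ℝ f) (oneJet u x)‖ ≤ F)
    {o : Fin n} (ho : 1 < lam o)
    (hmax : IsLocalMax (fun y => 2 * Real.log (9 / 16 - ‖y‖ ^ 2) + gradientTerm α β u y +
      Real.log (Real.log (dirDeriv (e o) (dirDeriv (e o) u) y))) x) :
    (9 / 16 - ‖x‖ ^ 2) ^ 2 * Real.log (lam o) ≤ C₀ := by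
  have hu1 : ∀ k, ContDiffOn ℝ 3 (dirDeriv (e k) u) Ω := fun k =>
    hu.dirDeriv hΩ (by norm_num) (e k)
  have hu2 : ∀ i k, ContDiffOn ℝ 2 (dirDeriv (e i) (dirDeriv (e k) u)) Ω := fun i k =>
    (hu1 k).dirDeriv hΩ (by norm_num) (e i)
  have hu3 : ∀ i j k, ContDiffOn ℝ 1 (dirDeriv (e i) (dirDeriv (e j) (dirDeriv (e k) u))) Ω :=
    fun i j k => (hu2 j k).dirDeriv hΩ (by norm_num) (e i)
  have c1 : ∀ i k, EqOn (dirDeriv (e i) (dirDeriv (e k) u)) (dirDeriv (e k) (dirDeriv (e i) u)) Ω :=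
    fun i k y hy => dirDeriv_comm hu hΩ (by norm_num) hy _ _
  have c2 : ∀ i j k, EqOn (dirDeriv (e i) (dirDeriv (e j) (dirDeriv (e k) u)))
      (dirDeriv (e j) (dirDeriv (e i) (dirDeriv (e k) u))) Ω :=
    fun i j k y hy => dirDeriv_comm (hu1 k) hΩ (by norm_num) hy _ _
  have c3 : ∀ i j k, EqOn (dirDeriv (e i) (dirDeriv (e j) (dirDeriv (e k) u)))
      (dirDeriv (e i) (dirDeriv (e k) (dirDeriv (e j) u))) Ω :=
    fun i j k y hy => dirDeriv_congr hΩ (c1 j k) hy _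
  -- Moving both `e o` derivatives inside takes four transpositions; the swap of the middle pair of
  -- derivatives in oiio uses all four derivatives of u.
  have c4 : ∀ i, dirDeriv (e o) (dirDeriv (e o) (dirDeriv (e i) (dirDeriv (e i) u))) x =
      dirDeriv (e i) (dirDeriv (e i) (dirDeriv (e o) (dirDeriv (e o) u))) x := fun i => by
    rw [dirDeriv_congr hΩ (c2 o i i) hx, dirDeriv_congr hΩ (c3 i o i) hx,
      dirDeriv_comm (hu2 i o) hΩ le_rfl hx, dirDeriv_congr hΩ (c2 o i o) hx]
  have hρ : 0 < 9 / 16 - ‖x‖ ^ 2 := by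
    have := pow_lt_pow_left₀ hxr (norm_nonneg x) two_ne_zero
    linarith
  have hline := fun i => (IsLocalMax.log_test_function
    (ρ := fun t : ℝ => 9 / 16 - ‖x + t • e i‖ ^ 2)
    (Z := fun t : ℝ => gradientTerm α β u (x + t • e i))
    (H := fun t : ℝ => dirDeriv (e o) (dirDeriv (e o) u) (x + t • e i))
    (Eventually.of_forall fun t => (hasDerivAt_cutoff_line x (e i) (9 / 16) t (e.norm_eq_one i)).1)
    (hasDerivAt_cutoff_line x (e i) (9 / 16) 0 (e.norm_eq_one i)).2
    ((eventually_line_mem hΩ hx (e i)).mono fun t ht =>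
      (hasDerivAt_gradientTerm_line e hΩ hu α β i ht).1)
    (hasDerivAt_gradientTerm_line e hΩ hu α β i (by simpa using hx)).2
    ((eventually_line_mem hΩ hx (e i)).mono fun t ht =>
      (hu2 o o).hasDerivAt_line hΩ (by norm_num) ht)
    ((hu3 i o o).hasDerivAt_line hΩ (by norm_num) (by simpa using hx))
    (by simpa using hρ) (by simpa [hdiag] using ho)
    (by
      have hc : ContinuousAt (fun t : ℝ => x + t • e i) 0 := (hasDerivAt_line x (e i) 0).continuousAt
      have hx0 : x + (0 : ℝ) • e i = x := by simp
      have h := hmax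
      rw [← hx0] at h
      exact IsMaxFilter.comp_tendsto (g := fun t : ℝ => x + t • e i) h hc))
  simp only [zero_smul, add_zero, hdiag, if_true] at hline
  have hsig := fun k => sigma_two_derivatives e hΩ hu hU hJU hf heq hx (e k)
  simp only [hdiag, if_true, ite_mul, zero_mul, sum_ite_eq, Finset.mem_univ] at hsig
  refine hC₀ o lam (fun i => dirDeriv (e i) u x) (fun i => inner ℝ (e i) x)
    (fun i => dirDeriv (e i) (dirDeriv (e i) (dirDeriv (e o) (dirDeriv (e o) u))) x)
    (fun i => fderiv ℝ f (oneJet u x) (0, 0, e i))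
    (fun i => fderiv ℝ f (oneJet u x) (jetDeriv e u (e i) x))
    (fun i j k => dirDeriv (e i) (dirDeriv (e j) (dirDeriv (e k) u)) x)
    (fderiv ℝ (fderiv ℝ f) (oneJet u x) (jetDeriv e u (e o) x) (jetDeriv e u (e o) x) +
        fderiv ℝ f (oneJet u x) (0, dirDeriv (e o) (dirDeriv (e o) u) x,
          ∑ k, dirDeriv (e o) (dirDeriv (e o) (dirDeriv (e k) u)) x • e k))
    (f (oneJet u x)) (9 / 16 - ‖x‖ ^ 2) (Real.log (lam o)) (fun i j k => c2 i j k hx) h0 ?_ hfm hfF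
    hgrad hρ ?_ (Real.log_pos ho) ?_ ?_ ?_ ?_ ?_ ?_ ?_ ?_
  · simpa [hdiag] using heq x hx
  · rw [← e.sum_sq_norm_inner_right x]
    simp
  · exact (Real.log_le_sub_one_of_pos (by linarith)).trans (by linarith)
  · intro i
    rw [← Real.norm_eq_abs]
    refine (ContinuousLinearMap.le_of_opNorm_le _ hf1 _).trans ?_
    refine mul_le_of_le_one_right (by linarith) (norm_triple_le ?_ ?_ ?_) <;> simp
  · intro i
    -- Splitting off the gradient slot isolates `a i * lam i`, the only part of the first derivative
    -- that involves the Hessian.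
    have e1 : jetDeriv e u (e i) x = (e i, dirDeriv (e i) u x, 0) + lam i • (0, 0, e i) := by
      simp [jetDeriv, hdiag, ite_smul]
    rw [e1, map_add, map_smul, smul_eq_mul, mul_comm (lam i), add_sub_cancel_right,
      ← Real.norm_eq_abs]
    refine (ContinuousLinearMap.le_of_opNorm_le _ hf1 _).trans ?_
    refine mul_le_mul_of_nonneg_left (norm_triple_le ?_ (hgrad i) ?_) (by linarith)
    · simpa using hK
    · simpa using zero_le_one.trans hK
  · have e1 : ((0, dirDeriv (e o) (dirDeriv (e o) u) x,
        ∑ k, dirDeriv (e o) (dirDeriv (e o) (dirDeriv (e k) u)) x • e k) : 𝔼 × ℝ × 𝔼) =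
        (0, lam o, 0) + ∑ k, dirDeriv (e o) (dirDeriv (e o) (dirDeriv (e k) u)) x •
          ((0, 0, e k) : 𝔼 × ℝ × 𝔼) := by
      simp [hdiag, Prod.ext_iff, Prod.fst_sum, Prod.snd_sum]
    have e2 : ‖jetDeriv e u (e o) x‖ ≤ lam o + K := by
      refine norm_triple_le ?_ ((hgrad o).trans (by linarith)) ?_
      · simp only [e.norm_eq_one]; linarith
      · simp only [hdiag, ite_smul, zero_smul, sum_ite_eq, Finset.mem_univ, if_true, norm_smul,
          e.norm_eq_one, mul_one, Real.norm_eq_abs, abs_of_nonneg (h0 o)]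
        linarith
    -- One F(l + K)² comes from D²f and one, in `e4`, from the z-derivative of f; together they give
    -- the 2F in `MaximumPointBound`.
    have e3 : |fderiv ℝ (fderiv ℝ f) (oneJet u x) (jetDeriv e u (e o) x) (jetDeriv e u (e o) x)| ≤
        F * (lam o + K) ^ 2 := by
      rw [← Real.norm_eq_abs]
      refine (ContinuousLinearMap.le_opNorm₂ _ _ _).trans ?_
      rw [mul_assoc, ← pow_two]
      exact mul_le_mul hf2 (pow_le_pow_left₀ (norm_nonneg _) e2 2) (by positivity) (by linarith)
    have e4 : |fderiv ℝ f (oneJet u x) (0, lam o, 0)| ≤ F * (lam o + K) ^ 2 := by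
      rw [← Real.norm_eq_abs]
      refine (ContinuousLinearMap.le_of_opNorm_le _ hf1 _).trans ?_
      refine mul_le_mul_of_nonneg_left (norm_triple_le ?_ ?_ ?_) (by linarith)
      · simp; positivity
      · rw [abs_of_nonneg (h0 o)]
        nlinarith
      · simp; positivity
    have e5 : ∀ k, dirDeriv (e k) (dirDeriv (e o) (dirDeriv (e o) u)) x =
        dirDeriv (e o) (dirDeriv (e o) (dirDeriv (e k) u)) x := fun k => by
      rw [c2 k o o hx, c3 o k o hx]
    simp only [e1, map_add, map_sum, map_smul, smul_eq_mul, e5]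
    have e6 := (abs_le.1 e3).1
    have e7 := (abs_le.1 e4).1
    simp only [mul_comm (fderiv ℝ f (oneJet u x) _)]
    linarith
  · intro k
    have e1 : ∀ i, dirDeriv (e i) (dirDeriv (e i) (dirDeriv (e k) u)) x =
        dirDeriv (e k) (dirDeriv (e i) (dirDeriv (e i) u)) x := fun i => by
      rw [c3 i i k hx, c2 i k i hx]
    simp only [e1]
    rw [← (hsig k).1, mul_sum, ← sum_sub_distrib]
    exact sum_congr rfl fun i _ => by ring
  · have e1 : ∀ i j, dirDeriv (e i) (dirDeriv (e j) (dirDeriv (e o) u)) x =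
        dirDeriv (e o) (dirDeriv (e i) (dirDeriv (e j) u)) x := fun i j => by
      rw [c3 i j o hx, c2 i o j hx]
    have h := (hsig o).2
    simp only [c4, sum_add_distrib, sum_ite_eq, Finset.mem_univ, if_true] at h
    simp only [e1, hdiag, if_true, sub_mul, sum_sub_distrib, ← mul_sum]
    linarith
  · intro i
    have h := (hline i).1
    simp only [mul_ite, mul_zero, sum_ite_eq, Finset.mem_univ, if_true] at h
    have e1 : 4 * inner ℝ (e i) x / (9 / 16 - ‖x‖ ^ 2) =
      -(2 * (-2 * inner ℝ (e i) x / (9 / 16 - ‖x‖ ^ 2))) := by ring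
    rw [e1]
    linarith
  · intro i
    refine le_trans (le_of_eq ?_) (hline i).2
    have e1 : ∑ k, ((if i = k then lam i else 0) ^ 2 + dirDeriv (e k) u x *
        dirDeriv (e i) (dirDeriv (e i) (dirDeriv (e k) u)) x) = lam i ^ 2 + ∑ k,
        dirDeriv (e k) u x * dirDeriv (e i) (dirDeriv (e i) (dirDeriv (e k) u)) x := by
      rw [sum_add_distrib]; simp
    rw [e1]
    generalize 9 / 16 - ‖x‖ ^ 2 = ρ
    ring

end MaximumPrinciple

/-! ### Global maximum of the auxiliary function. -/

section InteriorEstimate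
open Filter Topology

variable {n : ℕ}

local notation "𝔼" => EuclideanSpace ℝ (Fin n)

/-- Nonnegativity at v ± w gives 2|B(v, w)| ≤ B(v, v) + B(w, w). -/
theorem ContinuousLinearMap.norm_le_of_nonneg_of_quadratic_le {E : Type*} [NormedAddCommGroup E]
    [NormedSpace ℝ E] {B : E →L[ℝ] E →L[ℝ] ℝ} {C : ℝ} (hC : 0 ≤ C) (hB : ∀ v w, B v w = B w v)
    (h0 : ∀ v, 0 ≤ B v v) (h1 : ∀ v, ‖v‖ = 1 → B v v ≤ C) : ‖B‖ ≤ C := by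
  refine opNorm_le_of_unit_norm hC fun v hv => opNorm_le_of_unit_norm hC fun w hw => ?_
  have hp := h0 (v + w)
  have hm := h0 (v - w)
  simp only [map_add, map_sub, add_apply, sub_apply, hB w v] at hp hm
  have := h1 v hv
  have := h1 w hw
  rw [Real.norm_eq_abs, abs_le]
  constructor <;> linarith

theorem norm_iteratedFDeriv_two {E G : Type*} [NormedAddCommGroup E] [NormedSpace ℝ E]
    [NormedAddCommGroup G] [NormedSpace ℝ G] (f : E → G) (x : E) :
    ‖iteratedFDeriv ℝ 2 f x‖ = ‖fderiv ℝ (fderiv ℝ f) x‖ := by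
  rw [← norm_iteratedFDeriv_one, norm_iteratedFDeriv_fderiv]

theorem hessianMatrix_eq (u : 𝔼 → ℝ) (x : 𝔼) :
    hessianMatrix u x = Matrix.of fun i j => fderiv ℝ (fderiv ℝ u) x
      (EuclideanSpace.single i (1 : ℝ)) (EuclideanSpace.single j (1 : ℝ)) := by
  ext i j
  simp [hessianMatrix, iteratedFDeriv_two_apply]

theorem abs_gradientTerm_le {α β K : ℝ} (hα : 0 ≤ α) (hβ : 0 ≤ β) {u : 𝔼 → ℝ} {x : 𝔼}
    (hx : ‖x‖ ≤ 1) (hu : |u x| ≤ K) (hg : ‖gradient u x‖ ≤ K) :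
    |gradientTerm α β u x| ≤ α / 2 * K ^ 2 + β * (K + K) := by
  have h1 : |(inner ℝ x (gradient u x) : ℝ)| ≤ K :=
    (abs_real_inner_le_norm _ _).trans
      ((mul_le_of_le_one_left (norm_nonneg _) hx).trans hg)
  have h2 : |inner ℝ x (gradient u x) - u x| ≤ K + K :=
    (abs_sub _ _).trans (add_le_add h1 hu)
  have h3 := pow_le_pow_left₀ (norm_nonneg _) hg 2
  refine (abs_add_le _ _).trans (add_le_add ?_ ?_)
  · rw [abs_of_nonneg (by positivity)]
    exact mul_le_mul_of_nonneg_left h3 (by positivity)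
  · rw [abs_mul, abs_of_nonneg hβ]
    exact mul_le_mul_of_nonneg_left h2 hβ

/-- The auxiliary function whose maximum over points and directions controls the Hessian. -/
noncomputable def auxiliaryFunction (α β : ℝ) (u : 𝔼 → ℝ) (p : 𝔼 × 𝔼) : ℝ :=
  (9 / 16 - ‖p.1‖ ^ 2) ^ 2 * Real.exp (gradientTerm α β u p.1) *
    Real.log (max (fderiv ℝ (fderiv ℝ u) p.1 p.2 p.2) 1)

theorem continuousOn_auxiliaryFunction {u : 𝔼 → ℝ} {Ω : Set 𝔼} (hΩ : IsOpen Ω)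
    (hu : ContDiffOn ℝ 4 u Ω) (α β : ℝ) : ContinuousOn (auxiliaryFunction α β u) (Ω ×ˢ univ) := by
  have hfst : ContinuousOn (Prod.fst : 𝔼 × 𝔼 → 𝔼) (Ω ×ˢ univ) := continuousOn_fst
  have hmaps : MapsTo (Prod.fst : 𝔼 × 𝔼 → 𝔼) (Ω ×ˢ univ) Ω := fun p hp => hp.1
  have hgrad : ContinuousOn (gradient u) Ω :=
    (InnerProductSpace.toDual ℝ 𝔼).symm.continuous.comp_continuousOn
      (hu.continuousOn_fderiv_of_isOpen hΩ (by norm_num))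
  have hZ : ContinuousOn (gradientTerm α β u) Ω := by
    unfold gradientTerm
    exact (continuousOn_const.mul (hgrad.norm.pow 2)).add
      (continuousOn_const.mul ((ContinuousOn.inner continuousOn_id hgrad).sub
        hu.continuousOn))
  have hH : ContinuousOn (fderiv ℝ (fderiv ℝ u)) Ω :=
    (hu.fderiv_of_isOpen hΩ (m := 3) (by norm_num)).continuousOn_fderiv_of_isOpen hΩ (by norm_num)
  have hq : ContinuousOn (fun p : 𝔼 × 𝔼 => max (fderiv ℝ (fderiv ℝ u) p.1 p.2 p.2) 1)
      (Ω ×ˢ univ) :=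
    ContinuousOn.sup (((hH.comp hfst hmaps).clm_apply continuousOn_snd).clm_apply
      continuousOn_snd) continuousOn_const
  exact (((continuousOn_const.sub (hfst.norm.pow 2)).pow 2).mul
    (Real.continuous_exp.comp_continuousOn (hZ.comp hfst hmaps))).mul
      (hq.log fun p _ => (zero_lt_one.trans_le (le_max_right _ _)).ne')

/-- A value above the bound is positive, which rules out ρ = 0 and second derivative at most 1. So
the point is interior, the truncation by 1 is inactive nearby, and the logarithm of the function is
smooth there. -/
theorem auxiliaryFunction_le_of_isMaxOn {u : 𝔼 → ℝ} {f : 𝔼 × ℝ × 𝔼 → ℝ} {U : Set (𝔼 × ℝ × 𝔼)}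
    {K F m α β C₀ M : ℝ} (hK : 1 ≤ K) (hF : 1 ≤ F) (hC₀0 : 0 ≤ C₀)
    (hC₀ : MaximumPointBound n K F m α β C₀)
    (hu : ContDiffOn ℝ 4 u (ball 0 1)) (hc : ConvexOn ℝ (ball 0 1) u) (hU : IsOpen U)
    (hJU : ∀ x ∈ ball (0 : 𝔼) 1, oneJet u x ∈ U) (hf : ContDiffOn ℝ 2 f U)
    (heq : ∀ x ∈ ball (0 : 𝔼) 1, sigmaK 2 (hessianMatrix u x) = f (oneJet u x))
    (hgrad : ∀ x ∈ ball (0 : 𝔼) 1, ‖gradient u x‖ ≤ K)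
    (hfm : ∀ x ∈ ball (0 : 𝔼) 1, m ≤ f (oneJet u x))
    (hfF : ∀ x ∈ ball (0 : 𝔼) 1, ∀ k : ℕ, k ≤ 2 → ‖iteratedFDeriv ℝ k f (oneJet u x)‖ ≤ F)
    (hM : ∀ x ∈ ball (0 : 𝔼) 1, |gradientTerm α β u x| ≤ M) {p : 𝔼 × 𝔼}
    (hp : p ∈ closedBall (0 : 𝔼) (3 / 4) ×ˢ sphere (0 : 𝔼) 1)
    (hmax : IsMaxOn (auxiliaryFunction α β u) (closedBall (0 : 𝔼) (3 / 4) ×ˢ sphere (0 : 𝔼) 1) p) :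
    auxiliaryFunction α β u p ≤ C₀ * Real.exp M := by
  obtain ⟨x, ξ⟩ := p
  obtain ⟨hx, hξ⟩ := hp
  simp only [mem_closedBall_zero_iff, mem_sphere_zero_iff_norm] at hx hξ
  by_contra! hlt
  have hΩ : IsOpen (ball (0 : 𝔼) 1) := isOpen_ball
  have hpos : 0 < auxiliaryFunction α β u (x, ξ) := lt_of_le_of_lt (by positivity) hlt
  have hxΩ : x ∈ ball (0 : 𝔼) 1 := by
    rw [mem_ball_zero_iff]; linarith
  have hxr : ‖x‖ < 3 / 4 := by
    refine lt_of_le_of_ne hx fun h => ?_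
    have e1 : auxiliaryFunction α β u (x, ξ) = 0 := by
      simp only [auxiliaryFunction, h]; norm_num
    exact hpos.ne' e1
  have hH1 : 1 < fderiv ℝ (fderiv ℝ u) x ξ ξ := by
    by_contra! h
    have e1 : auxiliaryFunction α β u (x, ξ) = 0 := by
      simp only [auxiliaryFunction, max_eq_right h, Real.log_one, mul_zero]
    exact hpos.ne' e1
  have hsymm : ∀ y ∈ ball (0 : 𝔼) 1, ∀ v w, fderiv ℝ (fderiv ℝ u) y v w =
      fderiv ℝ (fderiv ℝ u) y w v := fun y hy v w => by
    rw [← dirDeriv_dirDeriv hu hΩ (by norm_num) hy, dirDeriv_comm hu hΩ (by norm_num) hy,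
      dirDeriv_dirDeriv hu hΩ (by norm_num) hy]
  obtain ⟨e, lam, hlam⟩ := exists_orthonormalBasis_diagonalizing (hsymm x hxΩ)
  have hdiag : ∀ i j, dirDeriv (e i) (dirDeriv (e j) u) x = if i = j then lam i else 0 :=
    fun i j => by
      rw [dirDeriv_dirDeriv hu hΩ (by norm_num) hxΩ, hlam]
      rcases eq_or_ne i j with rfl | h
      · simp [e.inner_eq_ite]
      · simp [e.inner_eq_ite, h, h.symm]
  have hlam0 : ∀ i, 0 ≤ lam i := fun i => by
    have := hc.dirDeriv_dirDeriv_nonneg hu hΩ (by norm_num) hxΩ (e i)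
    rwa [hdiag, if_pos rfl] at this
  have hne : (Finset.univ : Finset (Fin n)).Nonempty := by
    by_contra h
    rw [Finset.not_nonempty_iff_eq_empty] at h
    rw [hlam, h, Finset.sum_empty] at hH1
    linarith
  obtain ⟨o, -, ho⟩ := Finset.exists_max_image Finset.univ lam hne
  have hHo : fderiv ℝ (fderiv ℝ u) x (e o) (e o) = lam o := by
    have := hdiag o o
    rwa [dirDeriv_dirDeriv hu hΩ (by norm_num) hxΩ, if_pos rfl] at this
  have hξo : fderiv ℝ (fderiv ℝ u) x ξ ξ ≤ lam o := by
    have h1 : ∑ i, inner ℝ (e i) ξ * inner ℝ (e i) ξ = (1 : ℝ) := by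
      have := e.sum_sq_norm_inner_right ξ
      simpa [hξ, pow_two] using this
    rw [hlam, ← mul_one (lam o), ← h1, Finset.mul_sum]
    exact Finset.sum_le_sum fun i hi =>
      mul_le_mul_of_nonneg_right (ho i hi) (mul_self_nonneg _)
  have hlo : 1 < lam o := hH1.trans_le hξo
  have hρ : 0 < 9 / 16 - ‖x‖ ^ 2 := by
    have := pow_lt_pow_left₀ hxr (norm_nonneg x) two_ne_zero
    linarith
  -- The top eigenvector does at least as well as ξ, so with `e o` held fixed the point `x` is still
  -- a local maximum.
  have hle : auxiliaryFunction α β u (x, ξ) ≤ auxiliaryFunction α β u (x, e o) := by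
    simp only [auxiliaryFunction, hHo, max_eq_left hlo.le, max_eq_left hH1.le]
    exact mul_le_mul_of_nonneg_left (Real.log_le_log (by linarith) hξo) (by positivity)
  have hcont : ContinuousOn (dirDeriv (e o) (dirDeriv (e o) u)) (ball 0 1) :=
    ((hu.dirDeriv hΩ (m := 3) (by norm_num) (e o)).dirDeriv hΩ (m := 2) (by norm_num)
      (e o)).continuousOn
  have hnear1 : ∀ᶠ y in 𝓝 x, 1 < dirDeriv (e o) (dirDeriv (e o) u) y :=
    (hcont.continuousAt (hΩ.mem_nhds hxΩ)).tendsto.eventually_const_lt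
      (by rwa [hdiag, if_pos rfl])
  have hnear2 : ∀ᶠ y in 𝓝 x, y ∈ ball (0 : 𝔼) (3 / 4) :=
    isOpen_ball.mem_nhds (by rwa [mem_ball_zero_iff])
  have hlog : ∀ y, y ∈ ball (0 : 𝔼) (3 / 4) → 1 < dirDeriv (e o) (dirDeriv (e o) u) y →
      2 * Real.log (9 / 16 - ‖y‖ ^ 2) + gradientTerm α β u y +
        Real.log (Real.log (dirDeriv (e o) (dirDeriv (e o) u) y)) =
      Real.log (auxiliaryFunction α β u (y, e o)) ∧ 0 < auxiliaryFunction α β u (y, e o) := by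
    intro y hy h1
    rw [mem_ball_zero_iff] at hy
    have hyΩ : y ∈ ball (0 : 𝔼) 1 := by
      rw [mem_ball_zero_iff]; linarith
    have hρy : 0 < 9 / 16 - ‖y‖ ^ 2 := by
      have := pow_lt_pow_left₀ hy (norm_nonneg y) two_ne_zero
      linarith
    have hly := Real.log_pos h1
    simp only [auxiliaryFunction, ← dirDeriv_dirDeriv hu hΩ (by norm_num) hyΩ, max_eq_left h1.le]
    refine ⟨?_, by positivity⟩
    rw [Real.log_mul (by positivity) hly.ne', Real.log_mul (by positivity) (by positivity),
      Real.log_exp, Real.log_pow]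
    norm_num
  have hlocal : IsLocalMax (fun y => 2 * Real.log (9 / 16 - ‖y‖ ^ 2) + gradientTerm α β u y +
      Real.log (Real.log (dirDeriv (e o) (dirDeriv (e o) u) y))) x := by
    filter_upwards [hnear1, hnear2] with y h1 h2
    obtain ⟨q1, q2⟩ := hlog y h2 h1
    rw [q1, (hlog x hnear2.self_of_nhds hnear1.self_of_nhds).1]
    refine Real.log_le_log q2 ((hmax ?_).trans hle)
    exact ⟨ball_subset_closedBall h2, by simp⟩
  have key := local_max_estimate hK hF hC₀ e hΩ hu hU hJU hf
    (fun y hy => by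
      rw [← heq y hy, hessianMatrix_eq, two_mul_sigmaK_two (hsymm y hy) e]
      simp only [dirDeriv_dirDeriv hu hΩ (by norm_num) hy])
    hxΩ hxr hlam0 hdiag
    (fun i => by
      rw [dirDeriv, ← Real.norm_eq_abs]
      refine (ContinuousLinearMap.le_opNorm _ _).trans ?_
      rw [e.norm_eq_one, mul_one, ← toDual_gradient, LinearIsometryEquiv.norm_map]
      exact hgrad x hxΩ)
    (hfm x hxΩ)
    (by
      have := hfF x hxΩ 0 (by norm_num)
      rw [norm_iteratedFDeriv_zero] at this
      exact (le_abs_self _).trans this)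
    (by
      have := hfF x hxΩ 1 (by norm_num)
      rwa [norm_iteratedFDeriv_one] at this)
    (by
      have := hfF x hxΩ 2 le_rfl
      rwa [norm_iteratedFDeriv_two] at this)
    hlo hlocal
  refine absurd (hlt.trans_le hle) (not_lt.2 ?_)
  simp only [auxiliaryFunction, hHo, max_eq_left hlo.le]
  rw [mul_right_comm]
  exact mul_le_mul key (Real.exp_le_exp.2 ((le_abs_self _).trans (hM x hxΩ)))
    (Real.exp_pos _).le hC₀0

end InteriorEstimate

/-! ### The interior Hessian estimate. -/

theorem theorem3 (n : ℕ) (K F Λ : ℝ) :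
    ∃ C : ℝ,
      ∀ (u : EuclideanSpace ℝ (Fin n) → ℝ)
        (f : EuclideanSpace ℝ (Fin n) × ℝ × EuclideanSpace ℝ (Fin n) → ℝ)
        (U : Set (EuclideanSpace ℝ (Fin n) × ℝ × EuclideanSpace ℝ (Fin n))),
        -- `u` is `C⁴` up to the boundary and convex
        ContDiffOn ℝ 4 u (closedBall 0 1) →
        ConvexOn ℝ (ball 0 1) u →
        -- `f` is `C²` on an open set containing all points `(x, u(x), ∇u(x))`
        IsOpen U →
        (∀ x ∈ ball (0 : EuclideanSpace ℝ (Fin n)) 1, oneJet u x ∈ U) →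
        ContDiffOn ℝ 2 f U →
        -- the equation `σ₂(∇²u) = f(x, u, ∇u) > 0`
        (∀ x ∈ ball (0 : EuclideanSpace ℝ (Fin n)) 1,
          sigmaK 2 (hessianMatrix u x) = f (oneJet u x) ∧ 0 < f (oneJet u x)) →
        -- the bounds on `u` in `C¹`, on `f` in `C²` and on `1 / f`
        (∀ x ∈ ball (0 : EuclideanSpace ℝ (Fin n)) 1, |u x| ≤ K ∧ ‖gradient u x‖ ≤ K) →
        (∀ x ∈ ball (0 : EuclideanSpace ℝ (Fin n)) 1, ∀ k : ℕ, k ≤ 2 →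
          ‖iteratedFDeriv ℝ k f (oneJet u x)‖ ≤ F) →
        (∀ x ∈ ball (0 : EuclideanSpace ℝ (Fin n)) 1, 1 / f (oneJet u x) ≤ Λ) →
        ∀ x ∈ closedBall (0 : EuclideanSpace ℝ (Fin n)) (1 / 2),
          ‖iteratedFDeriv ℝ 2 u x‖ ≤ C := by
  -- Enlarging the bounds to at least 1 covers arbitrary real `K`, `F`, `Λ` and makes `m` a positive
  -- lower bound for f.
  set K' := max K 1
  set F' := max F 1
  set m := 1 / max Λ 1
  set α : ℝ := 450 * n / m with hα_def
  set β : ℝ := 2 * (450 * n / m) * K' + 2 with hβ_def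
  set M := α / 2 * K' ^ 2 + β * (K' + K')
  have hm : 0 < m := one_div_pos.2 (zero_lt_one.trans_le (le_max_right _ _))
  have hK' : 1 ≤ K' := le_max_right _ _
  have hF' : 1 ≤ F' := le_max_right _ _
  have hα : 0 ≤ α := by positivity
  have hβ : 0 ≤ β := by positivity
  obtain ⟨C₀, hC₀1, hC₀⟩ := maximum_point_estimate n hK' hF' hm hα_def hβ_def
  have hC₀0 : 0 ≤ C₀ := zero_le_one.trans hC₀1
  -- One factor e^M comes from the maximum point, the other from the lower bound of the exponential
  -- at `x`. On the half ball ρ ≥ 9/16 − 1/4 = 5/16, whence 256/25.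
  refine ⟨Real.exp (C₀ * Real.exp M * Real.exp M * (256 / 25)), ?_⟩
  intro u f U hu hc hU hJU hf heq hK hF hΛ x hx
  have hΩ : IsOpen (ball (0 : EuclideanSpace ℝ (Fin n)) 1) := isOpen_ball
  have hu' : ContDiffOn ℝ 4 u (ball 0 1) := hu.mono ball_subset_closedBall
  have hM : ∀ y ∈ ball (0 : EuclideanSpace ℝ (Fin n)) 1, |gradientTerm α β u y| ≤ M :=
    fun y hy => abs_gradientTerm_le hα hβ (mem_ball_zero_iff.1 hy).le
      ((hK y hy).1.trans (le_max_left _ _)) ((hK y hy).2.trans (le_max_left _ _))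
  have hfm : ∀ y ∈ ball (0 : EuclideanSpace ℝ (Fin n)) 1, m ≤ f (oneJet u y) := fun y hy =>
    (one_div_le (zero_lt_one.trans_le (le_max_right _ _)) (heq y hy).2).2
      ((hΛ y hy).trans (le_max_left _ _))
  have hS : IsCompact (closedBall (0 : EuclideanSpace ℝ (Fin n)) (3 / 4) ×ˢ
      sphere (0 : EuclideanSpace ℝ (Fin n)) 1) :=
    (isCompact_closedBall _ _).prod (isCompact_sphere _ _)
  have hSΩ : closedBall (0 : EuclideanSpace ℝ (Fin n)) (3 / 4) ⊆ ball 0 1 :=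
    closedBall_subset_ball (by norm_num)
  have hxS : x ∈ closedBall (0 : EuclideanSpace ℝ (Fin n)) (3 / 4) :=
    closedBall_subset_closedBall (by norm_num) hx
  have hxΩ := hSΩ hxS
  have hbound : ∀ p ∈ closedBall (0 : EuclideanSpace ℝ (Fin n)) (3 / 4) ×ˢ
      sphere (0 : EuclideanSpace ℝ (Fin n)) 1,
      auxiliaryFunction α β u p ≤ C₀ * Real.exp M := fun p hp => by
    obtain ⟨p₀, hp₀, hmax⟩ := hS.exists_isMaxOn ⟨p, hp⟩
      ((continuousOn_auxiliaryFunction hΩ hu' α β).mono (prod_mono hSΩ (subset_univ _)))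
    exact (hmax hp).trans (auxiliaryFunction_le_of_isMaxOn hK' hF' hC₀0 hC₀ hu' hc hU hJU hf
      (fun y hy => (heq y hy).1) (fun y hy => (hK y hy).2.trans (le_max_left _ _)) hfm
      (fun y hy k hk => (hF y hy k hk).trans (le_max_left _ _)) hM hp₀ hmax)
  rw [norm_iteratedFDeriv_two]
  refine ContinuousLinearMap.norm_le_of_nonneg_of_quadratic_le (Real.exp_pos _).le
    (fun v w => ?_) (fun v => ?_) fun v hv => ?_
  · rw [← dirDeriv_dirDeriv hu' hΩ (by norm_num) hxΩ, dirDeriv_comm hu' hΩ (by norm_num) hxΩ,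
      dirDeriv_dirDeriv hu' hΩ (by norm_num) hxΩ]
  · rw [← dirDeriv_dirDeriv hu' hΩ (by norm_num) hxΩ]
    exact hc.dirDeriv_dirDeriv_nonneg hu' hΩ (by norm_num) hxΩ v
  · have h1 := hbound (x, v) ⟨hxS, by simpa using hv⟩
    simp only [auxiliaryFunction] at h1
    set L := Real.log (max (fderiv ℝ (fderiv ℝ u) x v v) 1) with hL
    have hL0 : 0 ≤ L := Real.log_nonneg (le_max_right _ _)
    have h2 : (25 / 256 : ℝ) ≤ (9 / 16 - ‖x‖ ^ 2) ^ 2 := by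
      have s1 := pow_le_pow_left₀ (norm_nonneg x) (mem_closedBall_zero_iff.1 hx) 2
      have s2 := pow_le_pow_left₀ (by norm_num) (by linarith : (5 / 16 : ℝ) ≤ 9 / 16 - ‖x‖ ^ 2) 2
      linarith
    have h3 : 1 ≤ Real.exp (gradientTerm α β u x) * Real.exp M := by
      rw [← Real.exp_add]
      exact Real.one_le_exp (by linarith [(abs_le.1 (hM x hxΩ)).1])
    have h4 : L ≤ C₀ * Real.exp M * Real.exp M * (256 / 25) := by
      have s1 : (25 / 256 : ℝ) * L ≤ (9 / 16 - ‖x‖ ^ 2) ^ 2 * L :=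
        mul_le_mul_of_nonneg_right h2 hL0
      have s2 := mul_le_mul_of_nonneg_left h3
        (by positivity : 0 ≤ (9 / 16 - ‖x‖ ^ 2) ^ 2 * L)
      have s3 := mul_le_mul_of_nonneg_right h1 (Real.exp_pos M).le
      linarith
    refine (le_max_left _ 1).trans ?_
    rw [← Real.exp_log (zero_lt_one.trans_le (le_max_right (fderiv ℝ (fderiv ℝ u) x v v) 1))]
    exact Real.exp_le_exp.2 h4
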